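/- Let $T\ge 1$, and let $r_t:\mathbb R^n\to\mathbb R^p$, $g_t:\mathbb R^n\to\mathbb R^d$, $G_t,H_t:\mathbb R^n\to\mathbb R^m$ ($1\le t\le T$), $h_t:\mathbb R^n\times\mathbb R^n\to\mathbb R^q$ ($1\le t\le T-1$) and $h_T:\mathbb R^n\to\mathbb R^e$ be continuously differentiable ($e=0$, i.e. no terminal equality, is allowed). Consider the MPCC in $X=(x_1,\dots,x_T)$ $$\min_X\ \tfrac12\sum_{t=1}^T\|r_t(x_t)\|^2\quad\text{s.t.}\quad h_t(x_t,x_{t+1})=0\ (t<T),\ \ h_T(x_T)=0,\ \ g_t(x_t)\le 0,\ \ 0\le G_t(x_t)\perp H_t(x_t)\ge 0,$$ and its vertical form in $w=(X,Y,Z)$, in which the complementarity constraints are replaced by $G_t(x_t)-y_t=0$, $H_t(x_t)-z_t=0$ and $(Y,Z)\in\mathcal C:=\{(Y,Z):0\le Y\perp Z\ge 0\}$. Let $\bar h(w)$ stack all equality constraints of the vertical form and $g(w)$ all inequality constraints. For penalties $\rho_{\bar h},\rho_g>0$ and multipliers $\kappa,\mu$ put $$\Phi(w)=\tfrac12\sum_t\|r_t(x_t)\|^2+\tfrac{\rho_{\bar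 h}}2\Bigl\|\bar h(w)+\tfrac{\kappa}{\rho_{\bar h}}\Bigr\|^2+\tfrac{\rho_g}2\Bigl\|\bigl(g(w)+\tfrac{\mu}{\rho_g}\bigr)_+\Bigr\|^2 .$$ **Algorithm.** Given $\kappa^0,\mu^0,w^0$, $\rho_{\bar h}^0,\rho_g^0>0$, $\gamma>1$ and $\eta\in[0,1)$, for $k=0,1,2,\dots$ (without termination test): choose safeguarded multipliers $\bar\kappa^k,\bar\mu^k$ from $\kappa^k,\mu^k$ by some safeguarding rule (e.g. componentwise clipping to fixed intervals $[\kappa_{\min},\kappa_{\max}]$ and $[0,\mu_{\max}]$); let $\Phi^k$ be $\Phi$ with $(\rho^k_{\bar h},\rho^k_g,\bar\kappa^k,\bar\mu^k)$; by an inexact solve of $\min\Phi^k(w)$ s.t. $(Y,Z)\in\mathcal C$ obtain $w^{k+1}$ with $(Y^{k+1},Z^{k+1})\in\mathcal C$; set $\kappa^{k+1}=\bar\kappa^k+\rho_{\bar h}^k\bar h(w^{k+1})$, $\mu^{k+1}=(\bar\mu^k+\rho_g^kg(w^{k+1}))_+$, $\zeta^{k+1}=\min(\mu^{k+1},-g(w^{k+1}))$.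 If $k=0$ or $\max\{\|\zeta^{k+1}\|_\infty,\|\bar h(w^{k+1})\|_\infty\}\le\eta\max\{\|\zeta^k\|_\infty,\|\bar h(w^k)\|_\infty\}$, keep both penalties; otherwise multiply both by $\gamma$. **Residual.** Let $\mathcal Q_M=\mathbb R_{++}^2\cup(\mathbb R\times\{0\})\cup(\{0\}\times\mathbb R)$, and let $\mathcal M_M(w)$ be the set of $(u,v)$ with $u_i=0$ where $Y_i>0=Z_i$, $v_i=0$ where $Y_i=0<Z_i$, and $(u_i,v_i)\in\mathcal Q_M$ where $Y_i=Z_i=0$. Let $$r_{\rm in}(w)=\inf_{(u,v)\in\mathcal M_M(w)}\max\{\|\nabla_X\Phi^k\|_\infty,\|\nabla_Y\Phi^k-u\|_\infty,\|\nabla_Z\Phi^k-v\|_\infty,\|\min(Y,0)\|_\infty,\|\min(Z,0)\|_\infty,\|Y\circ Z\|_\infty\}.$$ **Stationarity and regularity.** For an MPCC $\min f$ s.t. $g_i\le0$, $h_j=0$, $0\le G_l\perp H_l\ge0$ and a feasible point $x^\star$, let $I_{0+},I_{+0},I_{00}$ be the index sets where, at $x^\star$, $G_l=0<H_l$, $G_l>0=H_l$,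 $G_l=H_l=0$ respectively. The point $x^\star$ is *M-stationary* if there are $\lambda\ge0$ with $\lambda_ig_i(x^\star)=0$ for all $i$, $\mu$, $u$, $v$ with $u_l=0$ on $I_{+0}$, $v_l=0$ on $I_{0+}$, $(u_l,v_l)\in\mathcal Q_M$ on $I_{00}$, and $\nabla f+\sum\lambda_i\nabla g_i+\sum\mu_j\nabla h_j-\sum u_l\nabla G_l-\sum v_l\nabla H_l=0$ at $x^\star$. *MPCC-RCPLD* holds at $x^\star$ if, for some (equivalently, any) index sets $J_1$, $L_2\subseteq I_{0+}$, $L_3\subseteq I_{+0}$ such that $\{\nabla h_j\}_{J_1}\cup\{\nabla G_l\}_{L_2}\cup\{\nabla H_l\}_{L_3}$ at $x^\star$ is a basis of the span of all $\nabla h_j$, of $\nabla G_l$ ($l\in I_{0+}$) and of $\nabla H_l$ ($l\in I_{+0}$), there is $\delta>0$ such that (i) that span has constant dimension on the ball $B_\delta(x^\star)$, these index sets being kept fixed; and (ii) for all sets $I_4$ of inequalities active at $x^\star$ and all $L_5,L_6\subseteq I_{00}$: if there are multipliers $(\lambda,\mu,u,v)\neq0$ with $\lambda\ge0$, $(u_l,v_l)\in\mathcal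 Q_M$ on $I_{00}$, supported on $I_4$, $J_1$, $L_2\cup L_5$, $L_3\cup L_6$ respectively, with $\sum\lambda_i\nabla g_i+\sum\mu_j\nabla h_j-\sum u_l\nabla G_l-\sum v_l\nabla H_l=0$ at $x^\star$, then the gradients $\{\nabla g_i\}_{I_4},\{\nabla h_j\}_{J_1},\{\nabla G_l\}_{L_2\cup L_5},\{\nabla H_l\}_{L_3\cup L_6}$ are linearly dependent at every $x\in B_\delta(x^\star)$. **Theorem.** Let $\{w^k\}$ be generated by the algorithm, suppose that $(\bar\kappa^k,\bar\mu^k)$ is bounded, and suppose that $r_{\rm in}(w^{k+1})\le\varepsilon_k$ for all $k\ge0$ (with $r_{\rm in}$ computed for $\Phi^k$), where $\varepsilon_k\downarrow0$. Then: 1. for every $k$, with the Euclidean distance and $N_{\mathcal C}$ the limiting normal cone, $$\operatorname{dist}\bigl(0,\nabla\Phi^k(w^{k+1})+\{0\}\times N_{\mathcal C}(Y^{k+1},Z^{k+1})\bigr)\le\sqrt{T(n+2m)}\;\varepsilon_k;$$ 2. every accumulation point $w^\star=(X^\star,Y^\star,Z^\star)$ of $\{w^k\}$ that is feasible for the vertical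 form and at which MPCC-RCPLD holds for the vertical form is M-stationary for the vertical form, and $X^\star$ is M-stationary for the original MPCC. -/

import Mathlib

open Filter Topology

noncomputable section

/-! ## Mathematical programs with complementarity constraints -/

/-- The program
`min f(x)` subject to `g i x ≤ 0`, `h j x = 0`, `0 ≤ G l x ⊥ H l x ≥ 0` on a Euclidean space. -/
structure MPCC (ι I J L : Type) where
  f : EuclideanSpace ℝ ι → ℝ
  g : I → EuclideanSpace ℝ ι → ℝ
  h : J → EuclideanSpace ℝ ι → ℝ
  G : L → EuclideanSpace ℝ ι → ℝ
  H : L → EuclideanSpace ℝ ι → ℝ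

/-- Labels of the individual constraint functions of an MPCC. -/
inductive ConstrIdx (I J L : Type) where
  | ineq (i : I)
  | eq (j : J)
  | compG (l : L)
  | compH (l : L)

/-- The set of labels made of inequalities in `a`, equalities in `b`, functions `G l` with `l ∈ c`
and functions `H l` with `l ∈ d`. -/
def pick {I J L : Type} (a : Set I) (b : Set J) (c d : Set L) : Set (ConstrIdx I J L) :=
  ConstrIdx.ineq '' a ∪ ConstrIdx.eq '' b ∪ ConstrIdx.compG '' c ∪ ConstrIdx.compH '' d

/-- The set `ℝ₊₊² ∪ (ℝ × {0}) ∪ ({0} × ℝ)` of admissible biactive multiplier pairs. -/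
def QM : Set (ℝ × ℝ) := {p | (0 < p.1 ∧ 0 < p.2) ∨ p.1 * p.2 = 0}

namespace MPCC

variable {ι I J L : Type} (P : MPCC ι I J L)

def Feasible (x : EuclideanSpace ℝ ι) : Prop :=
  (∀ i, P.g i x ≤ 0) ∧ (∀ j, P.h j x = 0) ∧
    ∀ l, 0 ≤ P.G l x ∧ 0 ≤ P.H l x ∧ P.G l x * P.H l x = 0

/-- The active inequalities. -/
def activeIneq (x : EuclideanSpace ℝ ι) : Set I := {i | P.g i x = 0}

/-- The indices with `G = 0 < H`. -/
def idx0p (x : EuclideanSpace ℝ ι) : Set L := {l | P.G l x = 0 ∧ 0 < P.H l x}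

/-- The indices with `G > 0 = H`. -/
def idxp0 (x : EuclideanSpace ℝ ι) : Set L := {l | 0 < P.G l x ∧ P.H l x = 0}

/-- The biactive indices `G = 0 = H`. -/
def idx00 (x : EuclideanSpace ℝ ι) : Set L := {l | P.G l x = 0 ∧ P.H l x = 0}

variable [Fintype ι]

/-- The gradient at `x` of the constraint function with a given label. -/
def grad (x : EuclideanSpace ℝ ι) : ConstrIdx I J L → EuclideanSpace ℝ ι
  | .ineq i => gradient (P.g i) x
  | .eq j => gradient (P.h j) x
  | .compG l => gradient (P.G l) x
  | .compH l => gradient (P.H l) x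

/-- The gradients at `x` of the labelled constraint functions, as an indexed family, are linearly
independent. -/
def GradIndep (x : EuclideanSpace ℝ ι) (s : Set (ConstrIdx I J L)) : Prop :=
  LinearIndependent ℝ (fun c : s => P.grad x c)

/-- The span at `x` of the gradients of the labelled constraint functions. -/
def gradSpan (x : EuclideanSpace ℝ ι) (s : Set (ConstrIdx I J L)) :
    Submodule ℝ (EuclideanSpace ℝ ι) :=
  Submodule.span ℝ (P.grad x '' s)

variable [Fintype I] [Fintype J] [Fintype L]

/-- The combination `∑ λᵢ ∇gᵢ + ∑ μⱼ ∇hⱼ - ∑ uₗ ∇Gₗ - ∑ vₗ ∇Hₗ` at `x`. -/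
def gradComb (x : EuclideanSpace ℝ ι) (lam : I → ℝ) (mu : J → ℝ) (u v : L → ℝ) :
    EuclideanSpace ℝ ι :=
  ∑ i, lam i • gradient (P.g i) x + ∑ j, mu j • gradient (P.h j) x
    - ∑ l, u l • gradient (P.G l) x - ∑ l, v l • gradient (P.H l) x

/-- Mordukhovich (M-) stationarity. -/
def MStationary (x : EuclideanSpace ℝ ι) : Prop :=
  P.Feasible x ∧
  ∃ (lam : I → ℝ) (mu : J → ℝ) (u v : L → ℝ),
    gradient P.f x + P.gradComb x lam mu u v = 0 ∧
    (∀ i, 0 ≤ lam i ∧ lam i * P.g i x = 0) ∧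
    (∀ l ∈ P.idxp0 x, u l = 0) ∧
    (∀ l ∈ P.idx0p x, v l = 0) ∧
    (∀ l ∈ P.idx00 x, (u l, v l) ∈ QM)

/-- The MPCC relaxed constant positive linear dependence condition (MPCC-RCPLD) at `xs`.

With `J₁, L₂ ⊆ I₀₊, L₃ ⊆ I₊₀` selecting a basis of the span of the gradients of all equalities, of
the `G l` with `l ∈ I₀₊` and of the `H l` with `l ∈ I₊₀`: near `xs` that span has constant
dimension, and whenever a choice of active inequalities `I₄` and biactive indices `L₅`, `L₆` admits
a nonzero multiplier (supported on the selected functions, with the M-type sign pattern) for which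
the combination of gradients vanishes at `xs`, the selected gradients are linearly dependent at
every point near `xs`. -/
def RCPLD (xs : EuclideanSpace ℝ ι) : Prop :=
  ∃ (J₁ : Set J) (L₂ L₃ : Set L),
    L₂ ⊆ P.idx0p xs ∧ L₃ ⊆ P.idxp0 xs ∧
    P.GradIndep xs (pick ∅ J₁ L₂ L₃) ∧
    P.gradSpan xs (pick ∅ J₁ L₂ L₃)
      = P.gradSpan xs (pick ∅ Set.univ (P.idx0p xs) (P.idxp0 xs)) ∧
    ∃ δ > 0,
      (∀ x ∈ Metric.ball xs δ,
        Module.finrank ℝ (P.gradSpan x (pick ∅ Set.univ (P.idx0p xs) (P.idxp0 xs)))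
          = Module.finrank ℝ (P.gradSpan xs (pick ∅ Set.univ (P.idx0p xs) (P.idxp0 xs)))) ∧
      ∀ (I₄ : Set I) (L₅ L₆ : Set L),
        I₄ ⊆ P.activeIneq xs → L₅ ⊆ P.idx00 xs → L₆ ⊆ P.idx00 xs →
        (∃ (lam : I → ℝ) (mu : J → ℝ) (u v : L → ℝ),
          (∀ i, 0 ≤ lam i) ∧ (∀ l ∈ P.idx00 xs, (u l, v l) ∈ QM) ∧
          (∀ i ∉ I₄, lam i = 0) ∧ (∀ j ∉ J₁, mu j = 0) ∧
          (∀ l ∉ L₂ ∪ L₅, u l = 0) ∧ (∀ l ∉ L₃ ∪ L₆, v l = 0) ∧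
          ¬ (lam = 0 ∧ mu = 0 ∧ u = 0 ∧ v = 0) ∧
          P.gradComb xs lam mu u v = 0) →
        ∀ x ∈ Metric.ball xs δ, ¬ P.GradIndep x (pick I₄ J₁ (L₂ ∪ L₅) (L₃ ∪ L₆))

end MPCC

/-! ## The limiting normal cone -/

section NormalCone

variable {E : Type*} [NormedAddCommGroup E] [InnerProductSpace ℝ E]

/-- The regular (Fréchet) normal cone of `S` at `x`. -/
def regularNormalCone (S : Set E) (x : E) : Set E :=
  {v | ∀ c > 0, ∀ᶠ z in 𝓝[S] x, inner ℝ v (z - x) ≤ c * ‖z - x‖}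

/-- The limiting (Mordukhovich) normal cone of `S` at `x`. -/
def limitingNormalCone (S : Set E) (x : E) : Set E :=
  {v | ∃ (xs vs : ℕ → E), (∀ k, xs k ∈ S) ∧ (∀ k, vs k ∈ regularNormalCone S (xs k)) ∧
    Tendsto xs atTop (𝓝 x) ∧ Tendsto vs atTop (𝓝 v)}

end NormalCone

/-! ## The trajectory-optimization MPCC, its vertical form, and the AuLa subproblem -/

/-- Coordinates of the trajectory `X = (x_t)` over `N + 1` time steps, `x_t ∈ ℝⁿ`. -/
abbrev XIdx (N n : ℕ) := Fin (N + 1) × Fin n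

/-- Complementarity pairs: `m` at each of the `N + 1` time steps. -/
abbrev PairIdx (N m : ℕ) := Fin (N + 1) × Fin m

/-- Coordinates of `w = (X, Y, Z)`. -/
abbrev WIdx (N n m : ℕ) := XIdx N n ⊕ (PairIdx N m ⊕ PairIdx N m)

/-- Components of `h(x_t, x_{t+1})`, `t = 1, …, T - 1`, and of the terminal equality. -/
abbrev HIdx (N q e : ℕ) := (Fin N × Fin q) ⊕ Fin e

/-- Components of the stacked equalities `h̄ = [h; G - y; H - z]`. -/
abbrev HBarIdx (N q e m : ℕ) := HIdx N q e ⊕ (PairIdx N m ⊕ PairIdx N m)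

/-- Problem data with horizon `T = N + 1`: residuals `r`, coupling equalities `h`, an equality
`hT` on the terminal state (absent if `e = 0`), inequalities `g` and complementarity functions
`G`, `H`. The functions may depend on the time step. -/
structure TrajData (N n p q e d m : ℕ) where
  r : Fin (N + 1) → EuclideanSpace ℝ (Fin n) → EuclideanSpace ℝ (Fin p)
  h : Fin N → EuclideanSpace ℝ (Fin n) × EuclideanSpace ℝ (Fin n) → EuclideanSpace ℝ (Fin q)
  hT : EuclideanSpace ℝ (Fin n) → EuclideanSpace ℝ (Fin e)
  g : Fin (N + 1) → EuclideanSpace ℝ (Fin n) → EuclideanSpace ℝ (Fin d)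
  G : Fin (N + 1) → EuclideanSpace ℝ (Fin n) → EuclideanSpace ℝ (Fin m)
  H : Fin (N + 1) → EuclideanSpace ℝ (Fin n) → EuclideanSpace ℝ (Fin m)

/-- The state `x_t` of a trajectory. -/
def stateAt {N n : ℕ} (X : EuclideanSpace ℝ (XIdx N n)) (t : Fin (N + 1)) :
    EuclideanSpace ℝ (Fin n) :=
  WithLp.toLp 2 fun i => X (t, i)

/-- The `X`-block of `w = (X, Y, Z)`. -/
def xPart {N n m : ℕ} (w : EuclideanSpace ℝ (WIdx N n m)) : EuclideanSpace ℝ (XIdx N n) :=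
  WithLp.toLp 2 fun s => w (Sum.inl s)

/-- The coordinates of the `Y`-block. -/
def yPart {N n m : ℕ} (w : EuclideanSpace ℝ (WIdx N n m)) : PairIdx N m → ℝ :=
  fun s => w (Sum.inr (Sum.inl s))

/-- The coordinates of the `Z`-block. -/
def zPart {N n m : ℕ} (w : EuclideanSpace ℝ (WIdx N n m)) : PairIdx N m → ℝ :=
  fun s => w (Sum.inr (Sum.inr s))

/-- The pair `(Y, Z)` as a point of Euclidean space. -/
def yzPart {N n m : ℕ} (w : EuclideanSpace ℝ (WIdx N n m)) :
    EuclideanSpace ℝ (PairIdx N m ⊕ PairIdx N m) :=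
  WithLp.toLp 2 fun s => w (Sum.inr s)

/-- The complementarity set `𝒞 = {(Y, Z) : 0 ≤ Y ⊥ Z ≥ 0}`. -/
def complSet (S : Type) : Set (EuclideanSpace ℝ (S ⊕ S)) :=
  {a | ∀ s : S, 0 ≤ a (Sum.inl s) ∧ 0 ≤ a (Sum.inr s) ∧ a (Sum.inl s) * a (Sum.inr s) = 0}

namespace TrajData

variable {N n p q e d m : ℕ} (D : TrajData N n p q e d m)

/-- All data are continuously differentiable. -/
def Smooth : Prop :=
  (∀ t, ContDiff ℝ 1 (D.r t)) ∧ (∀ t, ContDiff ℝ 1 (D.h t)) ∧ ContDiff ℝ 1 D.hT ∧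
    (∀ t, ContDiff ℝ 1 (D.g t)) ∧ (∀ t, ContDiff ℝ 1 (D.G t)) ∧ (∀ t, ContDiff ℝ 1 (D.H t))

/-- The objective `½ ∑ₜ r(x_t)ᵀ r(x_t)`. -/
def cost (X : EuclideanSpace ℝ (XIdx N n)) : ℝ :=
  (1 / 2) * ∑ t, ‖D.r t (stateAt X t)‖ ^ 2

/-- The equality constraints of the original problem. -/
def eqFun : HIdx N q e → EuclideanSpace ℝ (XIdx N n) → ℝ
  | Sum.inl (t, j), X => D.h t (stateAt X t.castSucc, stateAt X t.succ) j
  | Sum.inr j, X => D.hT (stateAt X (Fin.last N)) j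

/-- The original problem, in the variable `X`. -/
def original : MPCC (XIdx N n) (Fin (N + 1) × Fin d) (HIdx N q e) (PairIdx N m) where
  f := D.cost
  g := fun i X => D.g i.1 (stateAt X i.1) i.2
  h := D.eqFun
  G := fun l X => D.G l.1 (stateAt X l.1) l.2
  H := fun l X => D.H l.1 (stateAt X l.1) l.2

/-- The stacked equality constraints `h̄ = [h; G - y; H - z]`. -/
def hbar : HBarIdx N q e m → EuclideanSpace ℝ (WIdx N n m) → ℝ
  | Sum.inl j, w => D.eqFun j (xPart w)
  | Sum.inr (Sum.inl l), w => D.G l.1 (stateAt (xPart w) l.1) l.2 - yPart w l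
  | Sum.inr (Sum.inr l), w => D.H l.1 (stateAt (xPart w) l.1) l.2 - zPart w l

/-- The vertical form, in the variables `w = (X, Y, Z)`, with complementarity `0 ≤ y ⊥ z ≥ 0`
imposed directly on the slack variables. -/
def vertical : MPCC (WIdx N n m) (Fin (N + 1) × Fin d) (HBarIdx N q e m) (PairIdx N m) where
  f := fun w => D.cost (xPart w)
  g := fun i w => D.g i.1 (stateAt (xPart w) i.1) i.2
  h := D.hbar
  G := fun l w => yPart w l
  H := fun l w => zPart w l

/-- The augmented Lagrangian objective `Φ`: equalities and inequalities are penalized, the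
complementarity constraints are not. -/
def aula (ρh ρg : ℝ) (κ : HBarIdx N q e m → ℝ) (μ : Fin (N + 1) × Fin d → ℝ)
    (w : EuclideanSpace ℝ (WIdx N n m)) : ℝ :=
  D.cost (xPart w)
    + ρh / 2 * ∑ j, (D.hbar j w + κ j / ρh) ^ 2
    + ρg / 2 * ∑ i, (max (D.vertical.g i w + μ i / ρg) 0) ^ 2

end TrajData

/-! ## The inner residuals -/

section Residual

variable {N n m : ℕ}

/-- The stationarity-consistent complementarity multipliers `ℳ_M(w)`. -/
def multM (w : EuclideanSpace ℝ (WIdx N n m)) :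
    Set ((PairIdx N m → ℝ) × (PairIdx N m → ℝ)) :=
  {p | ∀ l, (0 < yPart w l ∧ zPart w l = 0 → p.1 l = 0) ∧
    (yPart w l = 0 ∧ 0 < zPart w l → p.2 l = 0) ∧
    (yPart w l = 0 ∧ zPart w l = 0 → (p.1 l, p.2 l) ∈ QM)}

/-- The primal complementarity violation (all norms are sup norms). -/
def rPri (w : EuclideanSpace ℝ (WIdx N n m)) : ℝ :=
  max ‖fun l => min (yPart w l) 0‖ (max ‖fun l => min (zPart w l) 0‖
    ‖fun l => yPart w l * zPart w l‖)

/-- The KKT residual `r_in(w; u, v)` for the inner objective `Φ` (all norms are sup norms). -/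
def rInAt (Φ : EuclideanSpace ℝ (WIdx N n m) → ℝ) (w : EuclideanSpace ℝ (WIdx N n m))
    (u v : PairIdx N m → ℝ) : ℝ :=
  max ‖fun s : XIdx N n => gradient Φ w (Sum.inl s)‖
    (max ‖yPart (gradient Φ w) - u‖ (max ‖zPart (gradient Φ w) - v‖ (rPri w)))

/-- The best achievable KKT residual `r_in(w)`, the infimum of `r_in(w; u, v)` over `ℳ_M(w)`. -/
def rIn (Φ : EuclideanSpace ℝ (WIdx N n m) → ℝ) (w : EuclideanSpace ℝ (WIdx N n m)) : ℝ :=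
  ⨅ p : multM w, rInAt Φ w p.1.1 p.1.2

/-- The set `∇Φ(w) + {0} × N_𝒞(Y, Z)`. -/
def stationaritySet (Φ : EuclideanSpace ℝ (WIdx N n m) → ℝ)
    (w : EuclideanSpace ℝ (WIdx N n m)) : Set (EuclideanSpace ℝ (WIdx N n m)) :=
  {a | ∃ ν, xPart ν = 0 ∧
    yzPart ν ∈ limitingNormalCone (complSet (PairIdx N m)) (yzPart w) ∧ a = gradient Φ w + ν}

end Residual

/-! ## The safeguarded outer loop -/

/-- Componentwise clipping to `[lo, hi]`. -/
def clip {S : Type} (lo hi : ℝ) (a : S → ℝ) : S → ℝ := fun s => max lo (min hi (a s))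

/-- Clipped multipliers are bounded. -/
theorem norm_clip_le {S : Type} [Fintype S] {lo hi : ℝ} (hlh : lo ≤ hi) (a : S → ℝ) :
    ‖clip lo hi a‖ ≤ max |lo| |hi| := by
  refine (pi_norm_le_iff_of_nonneg (le_max_of_le_left (abs_nonneg lo))).2 fun s => ?_
  rw [Real.norm_eq_abs]
  exact abs_le_max_abs_abs (le_max_left _ _) (max_le hlh (min_le_left _ _))

/-- The measure `max {‖ζ‖_∞, ‖h̄(w)‖_∞}`, with `ζ = min (μ, -g)`, monitored by the penalty update. -/
def outerViolation {N n p q e d m : ℕ} (D : TrajData N n p q e d m)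
    (w : EuclideanSpace ℝ (WIdx N n m)) (μ : Fin (N + 1) × Fin d → ℝ) : ℝ :=
  max ‖fun i => min (μ i) (-(D.vertical.g i w))‖ ‖fun j => D.hbar j w‖

/-- `w, κ, κ̄, μ, μ̄, ρ_h̄, ρ_g` are generated by the safeguarded AuLa outer loop with safeguarding
rules `Sκ`, `Sμ` (such as `fun _ => clip κmin κmax` and `fun _ => clip 0 μmax`), penalty increase
factor `γ` and violation factor `η`. At iteration `k` the inner solver returns some `w (k + 1)`
satisfying the complementarity constraints exactly; its accuracy is not part of this definition. -/
structure IsSafeguardedAuLa {N n p q e d m : ℕ} (D : TrajData N n p q e d m)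
    (Sκ : ℕ → (HBarIdx N q e m → ℝ) → (HBarIdx N q e m → ℝ))
    (Sμ : ℕ → (Fin (N + 1) × Fin d → ℝ) → (Fin (N + 1) × Fin d → ℝ))
    (γ η : ℝ)
    (w : ℕ → EuclideanSpace ℝ (WIdx N n m))
    (κ κbar : ℕ → HBarIdx N q e m → ℝ) (μ μbar : ℕ → Fin (N + 1) × Fin d → ℝ)
    (ρh ρg : ℕ → ℝ) : Prop where
  penalty_pos : 0 < ρh 0 ∧ 0 < ρg 0
  safeguard : ∀ k, κbar k = Sκ k (κ k) ∧ μbar k = Sμ k (μ k)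
  hard_constraint : ∀ k, yzPart (w (k + 1)) ∈ complSet (PairIdx N m)
  update_kappa : ∀ k j, κ (k + 1) j = κbar k j + ρh k * D.hbar j (w (k + 1))
  update_mu : ∀ k i, μ (k + 1) i = max (μbar k i + ρg k * D.vertical.g i (w (k + 1))) 0
  penalty_keep : ∀ k,
    (k = 0 ∨ outerViolation D (w (k + 1)) (μ (k + 1)) ≤ η * outerViolation D (w k) (μ k)) →
      ρh (k + 1) = ρh k ∧ ρg (k + 1) = ρg k
  penalty_increase : ∀ k,
    ¬ (k = 0 ∨ outerViolation D (w (k + 1)) (μ (k + 1)) ≤ η * outerViolation D (w k) (μ k)) →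
      ρh (k + 1) = γ * ρh k ∧ ρg (k + 1) = γ * ρg k

end

/-! ### Sign-preserving linear algebra and limits of multipliers. -/

section FiniteFamilies

variable {ι V : Type*} [Fintype ι] [AddCommGroup V] [Module ℝ V]

/-! Part 1 rests on the fact that the admissible multipliers `multM w` become, after a change of
sign, limiting normals to the complementarity set (`mem_limitingNormalCone_complSet`). A small
residual therefore gives an element of `∇Φ + {0} × N` with all coordinates small, and the square
root of the dimension converts the sup norm into the Euclidean one.

For part 2, the multiplier updates are exactly the coefficients in `∇Φ`, so the iterates are
asymptotically M-stationary for the vertical form (`IsSafeguardedAuLa.exists_approx_stationary`).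
Multipliers of inequalities inactive at the limit vanish: either the penalties diverge, or the
monitored violation tends to zero (`IsSafeguardedAuLa.tendsto_multiplier_of_inactive`). Since
complementarity holds exactly along the run, the zero patterns of `u` and `v` pass to the limit.

The multipliers may still be unbounded, and RCPLD is what controls them
(`MPCC.mStationary_of_tendsto`). By constant rank, the sign-free terms can be carried near the limit
by the chosen basis. A Carathéodory reduction that keeps signs then makes the gradients in use
linearly independent. Along a subsequence the index set in use is constant. If the reduced
multipliers have a bounded subsequence, a limit of it proves stationarity. Otherwise, normalizing
gives a nontrivial signed relation at the limit, so RCPLD makes the same gradients dependent at the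
nearby iterates, a contradiction.

Finally, the `Y` and `Z` components of the stationarity equation identify the multipliers of `G - y
= 0` and `H - z = 0` with `-u` and `-v`, which gives stationarity of the original problem. -/

theorem linearIndepOn_iff_forall_sum {A : ι → V} {s : Set ι} :
    LinearIndepOn ℝ A s ↔
      ∀ c : ι → ℝ, (∀ i ∉ s, c i = 0) → ∑ i, c i • A i = 0 → c = 0 := by
  rw [linearIndepOn_iff]
  constructor
  · intro h c hc hsum
    have := h (Finsupp.equivFunOnFinite.symm c) (by
      rw [Finsupp.mem_supported]
      intro i hi
      by_contra hn
      simp [hc i hn] at hi) (by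
      rw [Finsupp.linearCombination_apply, Finsupp.sum_fintype _ _ (by simp)]
      simpa using hsum)
    exact funext fun i => by simpa using DFunLike.congr_fun this i
  · intro h l hl hsum
    have := h l (fun i hi => by
      by_contra hn
      exact hi (hl (by simpa using hn))) (by
      rw [Finsupp.linearCombination_apply, Finsupp.sum_fintype _ _ (by simp)] at hsum
      exact hsum)
    exact DFunLike.coe_injective (by simpa using this)

theorem mem_span_image_iff_exists_sum {A : ι → V} {s : Set ι} {x : V} :
    x ∈ Submodule.span ℝ (A '' s) ↔
      ∃ c : ι → ℝ, (∀ i ∉ s, c i = 0) ∧ ∑ i, c i • A i = x := by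
  constructor
  · intro hx
    obtain ⟨l, hl, rfl⟩ := (Finsupp.mem_span_image_iff_linearCombination ℝ).1 hx
    refine ⟨l, fun i hi => ?_, ?_⟩
    · by_contra hn
      exact hi (hl (by simpa using hn))
    · rw [Finsupp.linearCombination_apply, Finsupp.sum_fintype _ _ (by simp)]
  · rintro ⟨c, hc, rfl⟩
    refine Submodule.sum_mem _ fun i _ => ?_
    by_cases hi : i ∈ s
    · exact Submodule.smul_mem _ _ (Submodule.subset_span ⟨i, hi, rfl⟩)
    · simp [hc i hi]

/-- A sign-preserving Carathéodory reduction relative to a linearly independent subfamily. -/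
theorem exists_signed_reduction {A : ι → V} {B : Set ι} (hB : LinearIndepOn ℝ A B) (a : ι → ℝ) :
    ∃ a' : ι → ℝ, ∑ i, a' i • A i = ∑ i, a i • A i ∧
      (∀ i ∉ B, a' i = 0 ∨ 0 < a i * a' i) ∧ LinearIndepOn ℝ A (B ∪ {i | a' i ≠ 0}) := by
  classical
  induction hn : (Finset.univ.filter fun i => i ∉ B ∧ a i ≠ 0).card using Nat.strong_induction_on
    generalizing a with
  | _ n ih =>
  by_cases hind : LinearIndepOn ℝ A (B ∪ {i | a i ≠ 0})
  · refine ⟨a, rfl, fun i _ => ?_, hind⟩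
    by_cases h : a i = 0
    · exact Or.inl h
    · exact Or.inr (mul_self_pos.2 h)
  rw [linearIndepOn_iff_forall_sum] at hind
  push Not at hind
  obtain ⟨c, hc, hsum, hc0⟩ := hind
  -- A relation supported inside the independent set `B` would be trivial, so `c` has a nonzero
  -- coefficient that may be eliminated.
  have hne : (Finset.univ.filter fun i => i ∉ B ∧ c i ≠ 0).Nonempty := by
    by_contra hemp
    refine hc0 (linearIndepOn_iff_forall_sum.1 hB c (fun i hi => ?_) hsum)
    by_contra h
    exact hemp ⟨i, by simp [hi, h]⟩
  obtain ⟨j, hj, hmin⟩ := Finset.exists_min_image _ (fun i => |a i / c i|) hne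
  simp only [Finset.mem_filter, Finset.mem_univ, true_and] at hj hmin
  -- The smallest ratio in absolute value: subtracting `t • c` kills the coefficient at `j`, and no
  -- coefficient outside `B` crosses zero.
  set t := a j / c j with ht
  have hbound : ∀ i ∉ B, |t * c i| ≤ |a i| := by
    intro i hi
    by_cases hci : c i = 0
    · simp [hci]
    · have := hmin i ⟨hi, hci⟩
      rw [abs_div (a i), le_div_iff₀ (abs_pos.2 hci)] at this
      rwa [abs_mul]
  have hsign : ∀ i ∉ B, a i - t * c i = 0 ∨ 0 < a i * (a i - t * c i) := by
    intro i hi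
    have h1 := hbound i hi
    by_cases h0 : a i - t * c i = 0
    · exact Or.inl h0
    right
    rcases lt_trichotomy (a i) 0 with h | h | h
    · rw [abs_of_neg h] at h1
      have h2 := (abs_le.1 h1).1
      have h3 : a i - t * c i < 0 := lt_of_le_of_ne (by linarith) h0
      exact mul_pos_of_neg_of_neg h h3
    · rw [h, abs_zero] at h1
      have : t * c i = 0 := abs_nonpos_iff.1 h1
      exact absurd (by rw [h, this, sub_zero]) h0
    · rw [abs_of_pos h] at h1
      have h2 := (abs_le.1 h1).2
      have h3 : 0 < a i - t * c i := lt_of_le_of_ne (by linarith) (Ne.symm h0)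
      exact mul_pos h h3
  have hlt : (Finset.univ.filter fun i => i ∉ B ∧ a i - t * c i ≠ 0).card < n := by
    rw [← hn]
    refine Finset.card_lt_card (Finset.ssubset_iff_of_subset (fun i hi => ?_) |>.2 ⟨j, ?_, ?_⟩)
    · simp only [Finset.mem_filter, Finset.mem_univ, true_and] at hi ⊢
      refine ⟨hi.1, fun h0 => ?_⟩
      rcases hsign i hi.1 with h | h
      · exact hi.2 h
      · simp [h0] at h
    · simp only [Finset.mem_filter, Finset.mem_univ, true_and]
      refine ⟨hj.1, fun h0 => hj.2 (hc j ?_)⟩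
      simp [hj.1, h0]
    · simp [ht, div_mul_cancel₀ _ hj.2]
  obtain ⟨a', h1, h2, h3⟩ := ih _ hlt (fun i => a i - t * c i) rfl
  refine ⟨a', ?_, fun i hi => ?_, h3⟩
  · rw [h1]
    simp only [sub_smul, Finset.sum_sub_distrib, mul_smul, ← Finset.smul_sum, hsum, smul_zero,
      sub_zero]
  · rcases h2 i hi with h | h
    · exact Or.inl h
    · rcases hsign i hi with h' | h'
      · simp [h'] at h
      · right
        have := mul_pos h' h
        have hsq : 0 < (a i - t * c i) ^ 2 := by
          have : a i - t * c i ≠ 0 := by rintro h0; simp [h0] at h'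
          positivity
        have h4 : 0 < (a i - t * c i) ^ 2 * (a i * a' i) := by nlinarith
        exact pos_of_mul_pos_right h4 hsq.le

/-- If `B` indexes a basis of the span over `E`, coefficients over `E` can be moved to `B` and the
remaining ones reduced, with their signs kept, to a linearly independent family containing `B`. -/
theorem exists_signed_reduction_of_span_le {A : ι → V} {B E : Set ι} (hBE : B ⊆ E)
    (hB : LinearIndepOn ℝ A B) (hspan : Submodule.span ℝ (A '' E) ≤ Submodule.span ℝ (A '' B))
    (a : ι → ℝ) :
    ∃ a' : ι → ℝ, ∑ i, a' i • A i = ∑ i, a i • A i ∧ (∀ i ∈ E, i ∉ B → a' i = 0) ∧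
      (∀ i ∉ E, a' i = 0 ∨ 0 < a i * a' i) ∧ LinearIndepOn ℝ A (B ∪ {i | a' i ≠ 0}) := by
  classical
  have hmem : ∑ i, E.indicator a i • A i ∈ Submodule.span ℝ (A '' B) :=
    hspan (mem_span_image_iff_exists_sum.2
      ⟨E.indicator a, fun i hi => Set.indicator_of_notMem hi a, rfl⟩)
  obtain ⟨b, hb, hsum⟩ := mem_span_image_iff_exists_sum.1 hmem
  -- The `E`-part of the sum is rewritten over `B` by `b`, losing signs there; off `E` the
  -- coefficients are still those of `a`.
  obtain ⟨a', h1, h2, h3⟩ := exists_signed_reduction hB (b + Eᶜ.indicator a)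
  refine ⟨a', ?_, fun i hi hiB => ?_, fun i hi => ?_, h3⟩
  · rw [h1]
    simp only [Pi.add_apply, add_smul, Finset.sum_add_distrib, hsum]
    rw [← Finset.sum_add_distrib]
    refine Finset.sum_congr rfl fun i _ => ?_
    rw [← add_smul]
    exact congrArg (· • A i) (congrFun (Set.indicator_self_add_compl E a) i)
  · rcases h2 i hiB with h | h
    · exact h
    · simp [hb i hiB, hi] at h
  · have hiB : i ∉ B := fun h => hi (hBE h)
    simpa [hb i hiB, hi] using h2 i hiB

end FiniteFamilies

/-- Linear independence is an open condition, so `B` keeps spanning a space of dimension `|B|`.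
Constant rank gives the span over `E` the same dimension, so the inclusion of spans is an equality.
-/
theorem eventually_linearIndepOn_and_span_le {ι V : Type*} [Fintype ι] [NormedAddCommGroup V]
    [NormedSpace ℝ V] [FiniteDimensional ℝ V] {A : ℕ → ι → V} {A₀ : ι → V}
    (hA : ∀ i, Tendsto (fun k => A k i) atTop (𝓝 (A₀ i))) {B E : Set ι} (hBE : B ⊆ E)
    (hB : LinearIndepOn ℝ A₀ B)
    (hspan : Submodule.span ℝ (A₀ '' B) = Submodule.span ℝ (A₀ '' E))
    (hrank : ∀ᶠ k in atTop, Module.finrank ℝ (Submodule.span ℝ (A k '' E)) =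
      Module.finrank ℝ (Submodule.span ℝ (A₀ '' E))) :
    ∀ᶠ k in atTop, LinearIndepOn ℝ (A k) B ∧
      Submodule.span ℝ (A k '' E) ≤ Submodule.span ℝ (A k '' B) := by
  classical
  have hcard : ∀ {A' : ι → V}, LinearIndepOn ℝ A' B →
      Module.finrank ℝ (Submodule.span ℝ (A' '' B)) = Fintype.card B := fun {A'} h => by
    rw [Set.image_eq_range]
    exact finrank_span_eq_card h
  have hopen : IsOpen {f : B → V | LinearIndependent ℝ f} := isOpen_setOfPred_linearIndependent
  have htend : Tendsto (fun k => fun i : B => A k i) atTop (𝓝 fun i : B => A₀ i) :=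
    tendsto_pi_nhds.2 fun i => hA i
  filter_upwards [htend.eventually (hopen.mem_nhds hB), hrank] with k hk hr
  refine ⟨hk, (Submodule.eq_of_le_of_finrank_eq (Submodule.span_mono (Set.image_mono hBE)) ?_).ge⟩
  rw [hr, ← hspan, hcard hk, hcard hB]

/-- Multipliers of an asymptotically vanishing combination either converge along a subsequence to
multipliers of a vanishing combination, or normalize to a nontrivial relation in the limit. -/
theorem exists_limit_multiplier {ι V : Type*} [Fintype ι] [NormedAddCommGroup V] [NormedSpace ℝ V]
    {A : ℕ → ι → V} {A₀ : ι → V} (hA : ∀ i, Tendsto (fun k => A k i) atTop (𝓝 (A₀ i)))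
    {b : ℕ → V} {b₀ : V} (hb : Tendsto b atTop (𝓝 b₀))
    {K : Set (ι → ℝ)} (hK : IsClosed K) (hcone : ∀ t : ℝ, 0 < t → ∀ a ∈ K, t • a ∈ K)
    {a : ℕ → ι → ℝ} (ha : ∀ k, a k ∈ K)
    (hlim : Tendsto (fun k => b k + ∑ i, a k i • A k i) atTop (𝓝 0)) :
    (∃ a₀ ∈ K, b₀ + ∑ i, a₀ i • A₀ i = 0) ∨
      ∃ a₀ ∈ K, a₀ ≠ 0 ∧ ∑ i, a₀ i • A₀ i = 0 := by
  by_cases hbd : ∃ R : ℝ, ∃ᶠ k in atTop, a k ∈ Metric.closedBall (0 : ι → ℝ) R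
  · left
    obtain ⟨R, hR⟩ := hbd
    obtain ⟨a₀, -, φ, hφ, hlima⟩ :=
      tendsto_subseq_of_frequently_bounded Metric.isBounded_closedBall hR
    refine ⟨a₀, hK.mem_of_tendsto hlima (Eventually.of_forall fun k => ha _), ?_⟩
    have h1 : Tendsto (fun k => b (φ k) + ∑ i, a (φ k) i • A (φ k) i) atTop
        (𝓝 (b₀ + ∑ i, a₀ i • A₀ i)) :=
      (hb.comp hφ.tendsto_atTop).add (tendsto_finsetSum _ fun i _ =>
        ((tendsto_pi_nhds.1 hlima) i).smul ((hA i).comp hφ.tendsto_atTop))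
    exact tendsto_nhds_unique h1 (hlim.comp hφ.tendsto_atTop)
  · right
    push Not at hbd
    have hnorm : Tendsto (fun k => ‖a k‖) atTop atTop := by
      refine tendsto_atTop.2 fun R => ?_
      filter_upwards [hbd R] with k hk
      rw [mem_closedBall_zero_iff, not_le] at hk
      exact hk.le
    have hinv : Tendsto (fun k => ‖a k‖⁻¹) atTop (𝓝 0) := hnorm.inv_tendsto_atTop
    have hpos : ∀ᶠ k in atTop, 0 < ‖a k‖ := hnorm.eventually_gt_atTop 0
    have hmem : ∀ k, ‖a k‖⁻¹ • a k ∈ Metric.closedBall (0 : ι → ℝ) 1 := fun k => by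
      rw [mem_closedBall_zero_iff, norm_smul, norm_inv, norm_norm]
      exact inv_mul_le_one
    obtain ⟨a₀, -, φ, hφ, hlima⟩ := tendsto_subseq_of_bounded Metric.isBounded_closedBall hmem
    have hφt := hφ.tendsto_atTop
    refine ⟨a₀, hK.mem_of_tendsto hlima ?_, ?_, ?_⟩
    · filter_upwards [hφt.eventually hpos] with k hk
      exact hcone _ (inv_pos.2 hk) _ (ha _)
    -- The normalized multipliers have norm one, so their limit is nonzero.
    · have h1 : Tendsto (fun k => ‖‖a (φ k)‖⁻¹ • a (φ k)‖) atTop (𝓝 1) := by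
        refine tendsto_const_nhds.congr' ?_
        filter_upwards [hφt.eventually hpos] with k hk
        rw [norm_smul, norm_inv, norm_norm, inv_mul_cancel₀ hk.ne']
      have := tendsto_nhds_unique hlima.norm h1
      rintro rfl
      simp at this
    -- Dividing by the diverging norm removes the convergent term `b`.
    · have h1 : Tendsto (fun k => ‖a (φ k)‖⁻¹ • b (φ k) +
          ∑ i, (‖a (φ k)‖⁻¹ • a (φ k)) i • A (φ k) i) atTop
          (𝓝 ((0 : ℝ) • b₀ + ∑ i, a₀ i • A₀ i)) :=
        ((hinv.comp hφt).smul (hb.comp hφt)).add (tendsto_finsetSum _ fun i _ =>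
          ((tendsto_pi_nhds.1 hlima) i).smul ((hA i).comp hφt))
      have h2 : Tendsto (fun k => ‖a (φ k)‖⁻¹ • (b (φ k) + ∑ i, a (φ k) i • A (φ k) i)) atTop
          (𝓝 ((0 : ℝ) • 0)) := (hinv.comp hφt).smul (hlim.comp hφt)
      have h3 := tendsto_nhds_unique h1 (h2.congr fun k => by
        simp only [smul_add, Finset.smul_sum, Pi.smul_apply, smul_assoc])
      simpa using h3

/-! ### The cone of biactive multiplier pairs. -/

theorem isClosed_QM : IsClosed QM := by
  -- The open quadrant may be closed up, because its boundary already lies on the axes.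
  have h : QM = {p : ℝ × ℝ | 0 ≤ p.1 ∧ 0 ≤ p.2} ∪ {p : ℝ × ℝ | p.1 * p.2 = 0} := by
    ext p
    simp only [QM, Set.mem_ofPred_eq, Set.mem_union]
    constructor
    · rintro (h | h)
      · exact Or.inl ⟨h.1.le, h.2.le⟩
      · exact Or.inr h
    · rintro (⟨h1, h2⟩ | h)
      · rcases h1.eq_or_lt with h | h
        · simp [← h]
        · rcases h2.eq_or_lt with h' | h'
          · simp [← h']
          · exact Or.inl ⟨h, h'⟩
      · exact Or.inr h
  rw [h]
  exact ((isClosed_le continuous_const continuous_fst).inter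
    (isClosed_le continuous_const continuous_snd)).union
      (isClosed_eq (continuous_fst.mul continuous_snd) continuous_const)

theorem mul_mem_QM {t a b : ℝ} (ht : 0 < t) (h : (a, b) ∈ QM) : (t * a, t * b) ∈ QM := by
  rcases h with h | h
  · exact Or.inl ⟨mul_pos ht h.1, mul_pos ht h.2⟩
  · right
    change t * a * (t * b) = 0
    change a * b = 0 at h
    rw [mul_mul_mul_comm, h, mul_zero]

/-- Membership depends only on the signs of the two entries and survives setting either to zero.
This is why the Carathéodory reduction must keep signs and nothing more. -/
theorem mem_QM_of_sign {a b a' b' : ℝ} (h : (a, b) ∈ QM) (ha : a' = 0 ∨ 0 < a * a')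
    (hb : b' = 0 ∨ 0 < b * b') : (a', b') ∈ QM := by
  rcases ha with rfl | ha
  · exact Or.inr (zero_mul _)
  rcases hb with rfl | hb
  · exact Or.inr (mul_zero _)
  rcases h with h | h
  · exact Or.inl ⟨(pos_iff_pos_of_mul_pos ha).1 h.1, (pos_iff_pos_of_mul_pos hb).1 h.2⟩
  · rcases mul_eq_zero.1 h with h | h
    · simp only at h; simp [h] at ha
    · simp only at h; simp [h] at hb

/-! ### Asymptotic M-stationarity under RCPLD. -/

namespace ConstrIdx

variable {I J L : Type}

def equivSum : ConstrIdx I J L ≃ (I ⊕ J) ⊕ (L ⊕ L) where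
  toFun
    | ineq i => .inl (.inl i)
    | eq j => .inl (.inr j)
    | compG l => .inr (.inl l)
    | compH l => .inr (.inr l)
  invFun
    | .inl (.inl i) => ineq i
    | .inl (.inr j) => eq j
    | .inr (.inl l) => compG l
    | .inr (.inr l) => compH l
  left_inv c := by cases c <;> rfl
  right_inv s := by rcases s with (_ | _) | (_ | _) <;> rfl

instance [Fintype I] [Fintype J] [Fintype L] : Fintype (ConstrIdx I J L) :=
  Fintype.ofEquiv _ equivSum.symm

theorem sum_eq [Fintype I] [Fintype J] [Fintype L] {M : Type*} [AddCommMonoid M]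
    (f : ConstrIdx I J L → M) :
    ∑ c, f c = ∑ i, f (ineq i) + ∑ j, f (eq j) + (∑ l, f (compG l) + ∑ l, f (compH l)) := by
  rw [← equivSum.symm.sum_comp, Fintype.sum_sum_type, Fintype.sum_sum_type, Fintype.sum_sum_type]
  rfl

/-- Coefficients of the gradients in `MPCC.gradComb`. -/
def coeff (lam : I → ℝ) (mu : J → ℝ) (u v : L → ℝ) : ConstrIdx I J L → ℝ
  | ineq i => lam i
  | eq j => mu j
  | compG l => -u l
  | compH l => -v l

variable {a : Set I} {b : Set J} {s t : Set L}

@[simp] theorem ineq_mem_pick {i : I} : ineq i ∈ pick a b s t ↔ i ∈ a := by simp [pick]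
@[simp] theorem eq_mem_pick {j : J} : eq j ∈ pick a b s t ↔ j ∈ b := by simp [pick]
@[simp] theorem compG_mem_pick {l : L} : compG l ∈ pick a b s t ↔ l ∈ s := by simp [pick]
@[simp] theorem compH_mem_pick {l : L} : compH l ∈ pick a b s t ↔ l ∈ t := by simp [pick]

end ConstrIdx

namespace MPCC

open ConstrIdx

variable {ι I J L : Type} (P : MPCC ι I J L)

/-- The M-type sign pattern at `x`, for coefficients supported on `s`. -/
def signCone (x : EuclideanSpace ℝ ι) (s : Set (ConstrIdx I J L)) :
    Set (ConstrIdx I J L → ℝ) :=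
  {a | (∀ i, 0 ≤ a (ineq i)) ∧ (∀ l ∈ P.idx00 x, (-a (compG l), -a (compH l)) ∈ QM) ∧
    ∀ c ∉ s, a c = 0}

theorem isClosed_signCone (x : EuclideanSpace ℝ ι) (s : Set (ConstrIdx I J L)) :
    IsClosed (P.signCone x s) := by
  have h1 : IsClosed {a : ConstrIdx I J L → ℝ | ∀ i, 0 ≤ a (ineq i)} := by
    simp only [Set.ofPred_forall]
    exact isClosed_iInter fun i => isClosed_le continuous_const (continuous_apply _)
  have h2 : IsClosed {a : ConstrIdx I J L → ℝ |
      ∀ l ∈ P.idx00 x, (-a (compG l), -a (compH l)) ∈ QM} := by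
    simp only [Set.ofPred_forall]
    exact isClosed_iInter fun l => isClosed_iInter fun _ => isClosed_QM.preimage
      ((continuous_apply _).neg.prodMk (continuous_apply _).neg)
  have h3 : IsClosed {a : ConstrIdx I J L → ℝ | ∀ c ∉ s, a c = 0} := by
    simp only [Set.ofPred_forall]
    exact isClosed_iInter fun c => isClosed_iInter fun _ =>
      isClosed_eq (continuous_apply _) continuous_const
  exact h1.inter (h2.inter h3)

theorem smul_mem_signCone {x : EuclideanSpace ℝ ι} {s : Set (ConstrIdx I J L)} {t : ℝ}
    (ht : 0 < t) {a : ConstrIdx I J L → ℝ} (ha : a ∈ P.signCone x s) :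
    t • a ∈ P.signCone x s := by
  refine ⟨fun i => mul_nonneg ht.le (ha.1 i), fun l hl => ?_, fun c hc => ?_⟩
  · simpa using mul_mem_QM ht (ha.2.1 l hl)
  · simp [ha.2.2 c hc]

variable [Fintype ι] [Fintype I] [Fintype J] [Fintype L]

theorem gradComb_eq_sum (x : EuclideanSpace ℝ ι) (lam : I → ℝ) (mu : J → ℝ) (u v : L → ℝ) :
    P.gradComb x lam mu u v = ∑ c, coeff lam mu u v c • P.grad x c := by
  rw [ConstrIdx.sum_eq]
  simp only [gradComb, coeff, grad, neg_smul, Finset.sum_neg_distrib]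
  abel

theorem gradComb_of_coeff (x : EuclideanSpace ℝ ι) (a : ConstrIdx I J L → ℝ) :
    P.gradComb x (fun i => a (ineq i)) (fun j => a (eq j)) (fun l => -a (compG l))
      (fun l => -a (compH l)) = ∑ c, a c • P.grad x c := by
  rw [gradComb_eq_sum]
  refine Finset.sum_congr rfl fun c _ => ?_
  cases c <;> simp [coeff]

set_option maxHeartbeats 1000000 in
variable {P} in
/-- Asymptotic M-stationarity along a sequence converging to an MPCC-RCPLD point implies
M-stationarity. -/
theorem mStationary_of_tendsto {xs : EuclideanSpace ℝ ι} (hfeas : P.Feasible xs)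
    (hR : P.RCPLD xs) (hf : ContinuousAt (gradient P.f) xs)
    (hgrad : ∀ c, ContinuousAt (fun x => P.grad x c) xs)
    {x : ℕ → EuclideanSpace ℝ ι} (hx : Tendsto x atTop (𝓝 xs))
    {lam : ℕ → I → ℝ} {mu : ℕ → J → ℝ} {u v : ℕ → L → ℝ} (hlam : ∀ k i, 0 ≤ lam k i)
    (hinact : ∀ i, P.g i xs < 0 → Tendsto (fun k => lam k i) atTop (𝓝 0))
    (hu : ∀ᶠ k in atTop, ∀ l ∈ P.idxp0 xs, u k l = 0)
    (hv : ∀ᶠ k in atTop, ∀ l ∈ P.idx0p xs, v k l = 0)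
    (hQ : ∀ᶠ k in atTop, ∀ l ∈ P.idx00 xs, (u k l, v k l) ∈ QM)
    (hlim : Tendsto (fun k => gradient P.f (x k) + P.gradComb (x k) (lam k) (mu k) (u k) (v k))
      atTop (𝓝 0)) : P.MStationary xs := by
  classical
  obtain ⟨J₁, L₂, L₃, hL₂, hL₃, hind, hspan, δ, hδ, hrank, hpld⟩ := hR
  set B : Set (ConstrIdx I J L) := pick ∅ J₁ L₂ L₃ with hBdef
  set E : Set (ConstrIdx I J L) := pick ∅ Set.univ (P.idx0p xs) (P.idxp0 xs) with hEdef
  -- `E` collects the sign-free multipliers and `F` the sign-constrained ones; labels outside both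
  -- carry zero coefficients for large `k`.
  set F : Set (ConstrIdx I J L) := pick (P.activeIneq xs) ∅ (P.idx00 xs) (P.idx00 xs) with hFdef
  have hBE : B ⊆ E := by
    intro c hc
    cases c with
    | ineq i => simp [hBdef] at hc
    | eq j => simp [hEdef]
    | compG l => exact compG_mem_pick.2 (hL₂ (compG_mem_pick.1 hc))
    | compH l => exact compH_mem_pick.2 (hL₃ (compH_mem_pick.1 hc))
  have hcases : ∀ l, l ∈ P.idx0p xs ∨ l ∈ P.idxp0 xs ∨ l ∈ P.idx00 xs := by
    intro l
    obtain ⟨h1, h2, h3⟩ := hfeas.2.2 l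
    rcases h1.eq_or_lt with h | h
    · rcases h2.eq_or_lt with h' | h'
      · exact Or.inr (Or.inr ⟨h.symm, h'.symm⟩)
      · exact Or.inl ⟨h.symm, h'⟩
    · exact Or.inr (Or.inl ⟨h, (mul_eq_zero.1 h3).resolve_left h.ne'⟩)
  have hA : ∀ c, Tendsto (fun k => P.grad (x k) c) atTop (𝓝 (P.grad xs c)) :=
    fun c => (hgrad c).tendsto.comp hx
  have hball : ∀ᶠ k in atTop, x k ∈ Metric.ball xs δ := hx.eventually (Metric.ball_mem_nhds xs hδ)
  have hbasis := eventually_linearIndepOn_and_span_le hA hBE hind hspan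
    (hball.mono fun k hk => hrank _ hk)
  -- multipliers of inactive inequalities are dropped
  let lamT : ℕ → I → ℝ := fun k i => if P.g i xs = 0 then lam k i else 0
  have hlimT : Tendsto (fun k => gradient P.f (x k) +
      P.gradComb (x k) (lamT k) (mu k) (u k) (v k)) atTop (𝓝 0) := by
    have h0 : Tendsto (fun k => ∑ i, (lam k i - lamT k i) • gradient (P.g i) (x k)) atTop
        (𝓝 (∑ i, (0 : ℝ) • gradient (P.g i) xs)) := by
      refine tendsto_finsetSum _ fun i _ => Tendsto.smul ?_ (hA (ineq i))
      by_cases hi : P.g i xs = 0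
      · simp [lamT, hi]
      · simpa [lamT, hi] using hinact i (lt_of_le_of_ne (hfeas.1 i) hi)
    have h1 := hlim.sub h0
    simp only [zero_smul, Finset.sum_const_zero, sub_zero] at h1
    refine h1.congr fun k => ?_
    simp only [gradComb, sub_smul, Finset.sum_sub_distrib]
    abel
  have hred : ∀ᶠ k in atTop, ∃ S : Set (ConstrIdx I J L), B ⊆ S ∧ S ⊆ B ∪ F ∧
      x k ∈ Metric.ball xs δ ∧
      P.GradIndep (x k) S ∧ ∃ a' ∈ P.signCone xs S, ∑ c, a' c • P.grad (x k) c =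
        P.gradComb (x k) (lamT k) (mu k) (u k) (v k) := by
    filter_upwards [hbasis, hball, hu, hv, hQ] with k hbk hballk huk hvk hQk
    obtain ⟨a', h1, h2, h3, h4⟩ := exists_signed_reduction_of_span_le hBE hbk.1 hbk.2
      (coeff (lamT k) (mu k) (u k) (v k))
    -- Labels in `E` outside `B` were emptied by the reduction. Labels outside `E ∪ F` had zero
    -- coefficients beforehand, and the reduction creates no new ones there.
    have hsupp : ∀ c ∉ B ∪ F, a' c = 0 := by
      intro c hc
      rw [Set.mem_union, not_or] at hc
      by_cases hcE : c ∈ E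
      · exact h2 c hcE hc.1
      · rcases h3 c hcE with h | h
        · exact h
        exfalso
        have : coeff (lamT k) (mu k) (u k) (v k) c = 0 := by
          cases c with
          | ineq i =>
            have : P.g i xs ≠ 0 := by simpa [hFdef, activeIneq] using hc.2
            simp [coeff, lamT, this]
          | eq j => simp [hEdef] at hcE
          | compG l =>
            simp only [hEdef, hFdef, compG_mem_pick] at hcE hc
            have := huk l ((hcases l).resolve_left hcE |>.resolve_right hc.2)
            simp [coeff, this]
          | compH l =>
            simp only [hEdef, hFdef, compH_mem_pick] at hcE hc
            have := hvk l ((hcases l).resolve_right fun h => h.elim hcE hc.2)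
            simp [coeff, this]
        simp [this] at h
    refine ⟨B ∪ {c | a' c ≠ 0}, Set.subset_union_left, ?_, hballk, h4, a', ⟨fun i => ?_,
      fun l hl => ?_, fun c hc => ?_⟩, by rw [h1, gradComb_eq_sum]⟩
    · refine Set.union_subset Set.subset_union_left fun c hc => ?_
      by_contra h
      exact hc (hsupp c h)
    · have hi : (ineq i : ConstrIdx I J L) ∉ E := by simp [hEdef]
      rcases h3 _ hi with h | h
      · exact h.ge
      · have hn : 0 ≤ coeff (lamT k) (mu k) (u k) (v k) (ineq i) := by
          simp only [coeff, lamT]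
          split_ifs
          exacts [hlam k i, le_rfl]
        exact (pos_of_mul_pos_right h hn).le
    · have hG : (compG l : ConstrIdx I J L) ∉ E := by
        simp only [hEdef, compG_mem_pick]
        exact fun h => h.2.ne' hl.2
      have hH : (compH l : ConstrIdx I J L) ∉ E := by
        simp only [hEdef, compH_mem_pick]
        exact fun h => h.1.ne' hl.1
      refine mem_QM_of_sign (hQk l hl) ?_ ?_
      · simpa [coeff] using h3 _ hG
      · simpa [coeff] using h3 _ hH
    · rw [Set.mem_union, not_or] at hc
      simpa using hc.2
  -- Pigeonhole: there are finitely many label sets, so one `S` serves infinitely many `k`.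
  obtain ⟨S, hS⟩ := frequently_exists.1 hred.frequently
  obtain ⟨φ, hφ, hφS⟩ := extraction_of_frequently_atTop hS
  have hBS := (hφS 0).1
  have hSF := (hφS 0).2.1
  choose a haK hasum using fun k => (hφS k).2.2.2.2
  have hφt := hφ.tendsto_atTop
  -- Since `B ⊆ S ⊆ B ∪ F`, the set `S` has exactly the shape of the families quantified over in
  -- RCPLD.
  have hSpick : pick {i | ineq i ∈ S} J₁ (L₂ ∪ {l | compG l ∈ S ∧ l ∈ P.idx00 xs})
      (L₃ ∪ {l | compH l ∈ S ∧ l ∈ P.idx00 xs}) = S := by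
    ext c
    cases c with
    | ineq i => simp
    | eq j =>
      simp only [eq_mem_pick]
      exact ⟨fun h => hBS (by simpa [hBdef] using h),
        fun h => by simpa [hBdef, hFdef] using hSF h⟩
    | compG l =>
      simp only [compG_mem_pick, Set.mem_union, Set.mem_ofPred_eq]
      refine ⟨fun h => h.elim (fun h => hBS (by simpa [hBdef] using h)) And.left, fun h => ?_⟩
      have := hSF h
      simp only [hBdef, hFdef, Set.mem_union, compG_mem_pick] at this
      exact this.imp_right fun h' => ⟨h, h'⟩
    | compH l =>
      simp only [compH_mem_pick, Set.mem_union, Set.mem_ofPred_eq]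
      refine ⟨fun h => h.elim (fun h => hBS (by simpa [hBdef] using h)) And.left, fun h => ?_⟩
      have := hSF h
      simp only [hBdef, hFdef, Set.mem_union, compH_mem_pick] at this
      exact this.imp_right fun h' => ⟨h, h'⟩
  rcases exists_limit_multiplier (fun c => (hA c).comp hφt) ((hf.tendsto.comp hx).comp hφt)
    (P.isClosed_signCone xs S) (fun t ht a ha => P.smul_mem_signCone ht ha) haK
    ((hlimT.comp hφt).congr fun k => by
      simp only [Function.comp_apply, ← hasum k]) with ⟨a₀, ha₀, hsum⟩ | ⟨a₀, ha₀, hne, hsum⟩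
  · refine ⟨hfeas, fun i => a₀ (ineq i), fun j => a₀ (eq j), fun l => -a₀ (compG l),
      fun l => -a₀ (compH l), by rw [gradComb_of_coeff]; exact hsum, fun i => ⟨ha₀.1 i, ?_⟩,
      fun l hl => ?_, fun l hl => ?_, ha₀.2.1⟩
    · by_cases hi : P.g i xs = 0
      · simp [hi]
      · have : a₀ (ineq i) = 0 := ha₀.2.2 _ fun h => hi (by
          simpa [hBdef, hFdef, activeIneq] using hSF h)
        simp [this]
    · have : a₀ (compG l) = 0 := ha₀.2.2 _ fun h => by
        have := hSF h
        simp only [hBdef, hFdef, Set.mem_union, compG_mem_pick] at this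
        rcases this with h | h
        · exact hl.1.ne' (hL₂ h).1
        · exact hl.1.ne' h.1
      simp [this]
    · have : a₀ (compH l) = 0 := ha₀.2.2 _ fun h => by
        have := hSF h
        simp only [hBdef, hFdef, Set.mem_union, compH_mem_pick] at this
        rcases this with h | h
        · exact hl.2.ne' (hL₃ h).2
        · exact hl.2.ne' h.2
      simp [this]
  -- The nontrivial limiting relation triggers RCPLD, which forces dependence at `x (φ 0)`, where
  -- the family `S` is independent.
  · exfalso
    refine hpld {i | ineq i ∈ S} {l | compG l ∈ S ∧ l ∈ P.idx00 xs}
      {l | compH l ∈ S ∧ l ∈ P.idx00 xs} (fun i hi => ?_) (fun l hl => hl.2) (fun l hl => hl.2)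
      ⟨fun i => a₀ (ineq i), fun j => a₀ (eq j), fun l => -a₀ (compG l), fun l => -a₀ (compH l),
        ha₀.1, ha₀.2.1, fun i hi => ha₀.2.2 _ hi, fun j hj => ha₀.2.2 _ ?_, fun l hl => ?_,
        fun l hl => ?_, ?_, by rw [gradComb_of_coeff]; exact hsum⟩ _ (hφS 0).2.2.1
      (by rw [hSpick]; exact (hφS 0).2.2.2.1)
    · simpa [hBdef, hFdef] using hSF hi
    · rw [← hSpick]; simpa using hj
    · exact neg_eq_zero.2 (ha₀.2.2 _ fun h => hl (compG_mem_pick.1 (hSpick.ge h)))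
    · exact neg_eq_zero.2 (ha₀.2.2 _ fun h => hl (compH_mem_pick.1 (hSpick.ge h)))
    · rintro ⟨h1, h2, h3, h4⟩
      refine hne (funext fun c => ?_)
      cases c with
      | ineq i => exact congrFun h1 i
      | eq j => exact congrFun h2 j
      | compG l => exact neg_eq_zero.1 (congrFun h3 l)
      | compH l => exact neg_eq_zero.1 (congrFun h4 l)

end MPCC

/-! ### Calculus: gradients of the data and of the augmented Lagrangian. -/

theorem hasDerivAt_max_zero_sq (x : ℝ) : HasDerivAt (fun y : ℝ => max y 0 ^ 2) (2 * max x 0) x := by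
  rw [hasDerivAt_iff_isLittleO]
  -- The first-order error is at most `(y - x) ^ 2` everywhere, including across the kink of `max y
  -- 0`.
  refine Asymptotics.IsBigO.trans_isLittleO (g := fun y => (y - x) ^ 2) ?_ ?_
  · refine Asymptotics.IsBigO.of_bound 1 (Eventually.of_forall fun y => ?_)
    rw [one_mul, Real.norm_eq_abs, Real.norm_eq_abs, abs_of_nonneg (sq_nonneg (y - x)), smul_eq_mul,
      abs_le]
    rcases max_cases y 0 with ⟨h1, h2⟩ | ⟨h1, h2⟩ <;> rcases max_cases x 0 with ⟨h3, h4⟩ | ⟨h3, h4⟩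
      <;> rw [h1, h3] <;> constructor <;> nlinarith [sq_nonneg (y - x), sq_nonneg x, sq_nonneg y]
  · simpa [sq] using (Asymptotics.isBigO_refl (fun y : ℝ => y - x) (𝓝 x)).mul_isLittleO
      ((Asymptotics.isLittleO_one_iff ℝ).2 (by
        simpa using (continuous_id.sub continuous_const).tendsto' (f := fun y : ℝ => y - x) x 0
          (by simp)))

theorem ContDiff.continuous_gradient {ι : Type*} [Fintype ι] {f : EuclideanSpace ℝ ι → ℝ}
    (hf : ContDiff ℝ 1 f) : Continuous (gradient f) :=
  (InnerProductSpace.toDual ℝ _).symm.continuous.comp (hf.continuous_fderiv one_ne_zero)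

theorem norm_le_sqrt_card_mul {ι : Type*} [Fintype ι] {a : EuclideanSpace ℝ ι} {c : ℝ} (hc : 0 ≤ c)
    (h : ∀ s, |a s| ≤ c) : ‖a‖ ≤ Real.sqrt (Fintype.card ι) * c := by
  rw [EuclideanSpace.norm_eq, ← Real.sqrt_sq hc, ← Real.sqrt_mul (Nat.cast_nonneg _)]
  refine Real.sqrt_le_sqrt ?_
  rw [← nsmul_eq_mul, ← Finset.card_univ, ← Finset.sum_const]
  exact Finset.sum_le_sum fun s _ => by
    rw [Real.norm_eq_abs]
    exact pow_le_pow_left₀ (abs_nonneg _) (h s) 2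

section Coordinates

variable {N n m : ℕ}

theorem contDiff_stateAt (t : Fin (N + 1)) :
    ContDiff ℝ 1 (fun X : EuclideanSpace ℝ (XIdx N n) => stateAt X t) :=
  contDiff_euclidean.2 fun i => (EuclideanSpace.proj (𝕜 := ℝ) (t, i)).contDiff

/-- `xPart` as a continuous linear map. -/
noncomputable def xPartL : EuclideanSpace ℝ (WIdx N n m) →L[ℝ] EuclideanSpace ℝ (XIdx N n) :=
  LinearMap.toContinuousLinearMap { toFun := xPart, map_add' := fun _ _ => rfl,
                                    map_smul' := fun _ _ => rfl }

theorem contDiff_xPart : ContDiff ℝ 1 (xPart : EuclideanSpace ℝ (WIdx N n m) → _) :=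
  (xPartL (N := N) (n := n) (m := m)).contDiff

theorem contDiff_yPart (l : PairIdx N m) :
    ContDiff ℝ 1 (fun w : EuclideanSpace ℝ (WIdx N n m) => yPart w l) :=
  contDiff_euclidean.1 contDiff_id (Sum.inr (Sum.inl l))

theorem contDiff_zPart (l : PairIdx N m) :
    ContDiff ℝ 1 (fun w : EuclideanSpace ℝ (WIdx N n m) => zPart w l) :=
  contDiff_euclidean.1 contDiff_id (Sum.inr (Sum.inr l))

theorem gradient_apply_coord {ι : Type*} [Fintype ι] [DecidableEq ι] (s : ι)
    (x : EuclideanSpace ℝ ι) :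
    gradient (fun y : EuclideanSpace ℝ ι => y s) x = EuclideanSpace.single s 1 := by
  refine HasGradientAt.gradient (hasGradientAt_iff_hasFDerivAt.2 ?_)
  have h : HasFDerivAt (fun y : EuclideanSpace ℝ ι => y s)
      (EuclideanSpace.proj s : EuclideanSpace ℝ ι →L[ℝ] ℝ) x :=
    (EuclideanSpace.proj s : EuclideanSpace ℝ ι →L[ℝ] ℝ).hasFDerivAt
  refine h.congr_fderiv ?_
  ext y
  simp [EuclideanSpace.inner_single_left]

/-- The vector `(0, u, v)`. -/
def slackVec (u v : PairIdx N m → ℝ) : EuclideanSpace ℝ (WIdx N n m) :=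
  WithLp.toLp 2 (Sum.elim 0 (Sum.elim u v))

theorem sum_smul_gradient_slack (u v : PairIdx N m → ℝ) (w : EuclideanSpace ℝ (WIdx N n m)) :
    ∑ l, u l • gradient (fun w : EuclideanSpace ℝ (WIdx N n m) => yPart w l) w +
      ∑ l, v l • gradient (fun w : EuclideanSpace ℝ (WIdx N n m) => zPart w l) w =
        slackVec u v := by
  have hy : ∀ l, gradient (fun w : EuclideanSpace ℝ (WIdx N n m) => yPart w l) w =
    EuclideanSpace.single (Sum.inr (Sum.inl l)) 1 := fun l => gradient_apply_coord _ _
  have hz : ∀ l, gradient (fun w : EuclideanSpace ℝ (WIdx N n m) => zPart w l) w =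
    EuclideanSpace.single (Sum.inr (Sum.inr l)) 1 := fun l => gradient_apply_coord _ _
  simp only [hy, hz]
  ext s
  rcases s with s | s | s <;>
    simp [slackVec, Finset.sum_apply, Pi.single_apply]

end Coordinates

namespace TrajData

variable {N n p q e d m : ℕ} {D : TrajData N n p q e d m}

theorem Smooth.contDiff_cost (hD : D.Smooth) : ContDiff ℝ 1 D.cost :=
  contDiff_const.mul (ContDiff.sum fun t _ => ((hD.1 t).comp (contDiff_stateAt t)).norm_sq ℝ)

theorem Smooth.contDiff_g (hD : D.Smooth) (i : Fin (N + 1) × Fin d) :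
    ContDiff ℝ 1 (D.original.g i) :=
  contDiff_euclidean.1 ((hD.2.2.2.1 i.1).comp (contDiff_stateAt i.1)) i.2

theorem Smooth.contDiff_eqFun (hD : D.Smooth) (j : HIdx N q e) : ContDiff ℝ 1 (D.eqFun j) := by
  rcases j with ⟨t, j⟩ | j
  · exact contDiff_euclidean.1
      ((hD.2.1 t).comp ((contDiff_stateAt t.castSucc).prodMk (contDiff_stateAt t.succ))) j
  · exact contDiff_euclidean.1 (hD.2.2.1.comp (contDiff_stateAt (Fin.last N))) j

theorem Smooth.contDiff_G (hD : D.Smooth) (l : PairIdx N m) : ContDiff ℝ 1 (D.original.G l) :=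
  contDiff_euclidean.1 ((hD.2.2.2.2.1 l.1).comp (contDiff_stateAt l.1)) l.2

theorem Smooth.contDiff_H (hD : D.Smooth) (l : PairIdx N m) : ContDiff ℝ 1 (D.original.H l) :=
  contDiff_euclidean.1 ((hD.2.2.2.2.2 l.1).comp (contDiff_stateAt l.1)) l.2

theorem Smooth.contDiff_vertical_g (hD : D.Smooth) (i : Fin (N + 1) × Fin d) :
    ContDiff ℝ 1 (D.vertical.g i) :=
  (hD.contDiff_g i).comp contDiff_xPart

theorem Smooth.contDiff_hbar (hD : D.Smooth) (j : HBarIdx N q e m) : ContDiff ℝ 1 (D.hbar j) := by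
  rcases j with j | l | l
  · exact (hD.contDiff_eqFun j).comp contDiff_xPart
  · exact ((hD.contDiff_G l).comp contDiff_xPart).sub (contDiff_yPart l)
  · exact ((hD.contDiff_H l).comp contDiff_xPart).sub (contDiff_zPart l)

theorem Smooth.contDiff_vertical_f (hD : D.Smooth) : ContDiff ℝ 1 D.vertical.f :=
  hD.contDiff_cost.comp contDiff_xPart

theorem Smooth.continuous_vertical_grad (hD : D.Smooth)
    (c : ConstrIdx (Fin (N + 1) × Fin d) (HBarIdx N q e m) (PairIdx N m)) :
    Continuous fun w => D.vertical.grad w c := by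
  cases c with
  | ineq i => exact (hD.contDiff_vertical_g i).continuous_gradient
  | eq j => exact (hD.contDiff_hbar j).continuous_gradient
  | compG l => exact (contDiff_yPart l).continuous_gradient
  | compH l => exact (contDiff_zPart l).continuous_gradient

/-- The chain rule produces `ρ (h + κ / ρ) = κ + ρ h`, and positivity of `ρ` lets it pass inside the
maximum. The coefficients are thus the updated multipliers. -/
theorem Smooth.gradient_aula (hD : D.Smooth) {ρh ρg : ℝ} (hρh : 0 < ρh) (hρg : 0 < ρg)
    (κ : HBarIdx N q e m → ℝ) (μ : Fin (N + 1) × Fin d → ℝ)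
    (w : EuclideanSpace ℝ (WIdx N n m)) :
    gradient (D.aula ρh ρg κ μ) w = gradient D.vertical.f w +
      ∑ j, (κ j + ρh * D.hbar j w) • gradient (D.hbar j) w +
      ∑ i, max (μ i + ρg * D.vertical.g i w) 0 • gradient (D.vertical.g i) w := by
  refine HasGradientAt.gradient (hasGradientAt_iff_hasFDerivAt.2 ?_)
  have hf := (hD.contDiff_vertical_f.differentiable one_ne_zero w).hasFDerivAt
  have hh := fun j => (hD.contDiff_hbar j |>.differentiable one_ne_zero w).hasFDerivAt
  have hg := fun i => (hD.contDiff_vertical_g i |>.differentiable one_ne_zero w).hasFDerivAt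
  have h1 := (HasFDerivAt.fun_sum (u := Finset.univ)
    fun j _ => ((hh j).add_const (κ j / ρh)).pow 2).const_mul (ρh / 2)
  have h2 := (HasFDerivAt.fun_sum (u := Finset.univ) fun i _ =>
    (hasDerivAt_max_zero_sq (D.vertical.g i w + μ i / ρg)).comp_hasFDerivAt w
      ((hg i).add_const (μ i / ρg))).const_mul (ρg / 2)
  refine ((hf.add h1).add h2).congr_fderiv ?_
  simp only [map_add, map_sum, map_smulₛₗ, conj_trivial, toDual_gradient, Finset.smul_sum, smul_smul]
  congr 1
  · congr 1
    refine Finset.sum_congr rfl fun j _ => ?_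
    congr 1
    have := mul_div_cancel₀ (κ j) hρh.ne'
    simp only [Nat.add_one_sub_one, pow_one, nsmul_eq_mul, Nat.cast_ofNat]
    linear_combination this
  · refine Finset.sum_congr rfl fun i _ => ?_
    congr 1
    have : μ i + ρg * D.vertical.g i w = ρg * (D.vertical.g i w + μ i / ρg) := by
      rw [mul_add, mul_div_cancel₀ _ hρg.ne', add_comm]
    rw [this, ← mul_zero ρg, ← mul_max_of_nonneg _ _ hρg.le, mul_zero]
    ring

end TrajData

/-! ### From the residual to approximate multipliers. -/

section Residual

variable {N n m : ℕ} {Φ : EuclideanSpace ℝ (WIdx N n m) → ℝ} {w : EuclideanSpace ℝ (WIdx N n m)}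

/-- The strict bound allows the use of near-minimizers, so the infimum need not be attained. -/
theorem exists_multiplier_of_rIn_lt {c : ℝ} (h : rIn Φ w < c) :
    ∃ u v : PairIdx N m → ℝ, (u, v) ∈ multM w ∧ 
      ∀ s, |(gradient Φ w - slackVec u v : EuclideanSpace ℝ (WIdx N n m)) s| ≤ c := by
  have : Nonempty (multM w) := ⟨⟨(0, 0), fun l => by simp [QM]⟩⟩
  obtain ⟨⟨⟨u, v⟩, huv⟩, hlt⟩ := exists_lt_of_ciInf_lt h
  simp only [rInAt, max_lt_iff] at hlt
  refine ⟨u, v, huv, fun s => ?_⟩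
  rcases s with s | s | s
  · simpa [slackVec] using (norm_le_pi_norm (fun s => gradient Φ w (Sum.inl s)) s).trans hlt.1.le
  · simpa [slackVec, yPart] using
      (norm_le_pi_norm (yPart (gradient Φ w) - u) s).trans hlt.2.1.le
  · simpa [slackVec, zPart] using
      (norm_le_pi_norm (zPart (gradient Φ w) - v) s).trans hlt.2.2.1.le

theorem rIn_nonneg : 0 ≤ rIn Φ w :=
  Real.iInf_nonneg fun _ => (norm_nonneg _).trans (le_max_left _ _)

end Residual

/-! ### Normals to the complementarity set. -/

section ComplementaritySet

variable {S : Type} [Fintype S]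

/-- A positive coordinate stays positive nearby, which forces its partner to stay zero. Every
summand of `⟪ν, z - a⟫` is then nonpositive, so the error term `c * ‖z - a‖` is only slack. -/
theorem mem_regularNormalCone_complSet {a ν : EuclideanSpace ℝ (S ⊕ S)}
    (h : ∀ s, (0 < a (.inl s) ∧ a (.inr s) = 0 ∧ ν (.inl s) = 0) ∨
      (a (.inl s) = 0 ∧ 0 < a (.inr s) ∧ ν (.inr s) = 0) ∨
      (a (.inl s) = 0 ∧ a (.inr s) = 0 ∧ ν (.inl s) ≤ 0 ∧ ν (.inr s) ≤ 0)) :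
    ν ∈ regularNormalCone (complSet S) a := by
  intro c hc
  have hpos : ∀ i, ∀ᶠ z in 𝓝[complSet S] a, 0 < a i → 0 < z i := by
    intro i
    by_cases hi : 0 < a i
    · have hcont : Continuous fun z : EuclideanSpace ℝ (S ⊕ S) => z i :=
        (EuclideanSpace.proj (𝕜 := ℝ) i).continuous
      exact ((hcont.tendsto a).eventually (lt_mem_nhds hi)).filter_mono nhdsWithin_le_nhds
        |>.mono fun z hz _ => hz
    · exact Eventually.of_forall fun z h => absurd h hi
  filter_upwards [eventually_all.2 hpos, self_mem_nhdsWithin] with z hz hzS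
  refine le_trans ?_ (mul_nonneg hc.le (norm_nonneg _))
  rw [PiLp.inner_apply, Fintype.sum_sum_type, ← Finset.sum_add_distrib]
  refine Finset.sum_nonpos fun s _ => ?_
  simp only [PiLp.sub_apply, RCLike.inner_apply, conj_trivial]
  obtain ⟨hy, hz', hyz⟩ := hzS s
  rcases h s with ⟨h1, h2, h3⟩ | ⟨h1, h2, h3⟩ | ⟨h1, h2, h3, h4⟩
  · have := (mul_eq_zero.1 hyz).resolve_left (hz _ h1).ne'
    simp [h2, h3, this]
  · have := (mul_eq_zero.1 hyz).resolve_right (hz _ h2).ne'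
    simp [h1, h3, this]
  · rw [h1, h2, sub_zero, sub_zero]
    nlinarith

theorem mem_limitingNormalCone_complSet {a ν : EuclideanSpace ℝ (S ⊕ S)} (ha : a ∈ complSet S)
    (h : ∀ s, (0 < a (.inl s) ∧ a (.inr s) = 0 → ν (.inl s) = 0) ∧
      (a (.inl s) = 0 ∧ 0 < a (.inr s) → ν (.inr s) = 0) ∧
      (a (.inl s) = 0 ∧ a (.inr s) = 0 → (-ν (.inl s), -ν (.inr s)) ∈ QM)) :
    ν ∈ limitingNormalCone (complSet S) a := by
  classical
  -- At a biactive pair with a vanishing normal component, `b` moves off the corner along that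
  -- component's axis; the other component is then unrestricted. If neither vanishes, both are
  -- negative and the pair stays at the corner. Hence `ν` itself is a regular normal at every `a + t
  -- • b`, `t > 0`.
  let b : EuclideanSpace ℝ (S ⊕ S) := WithLp.toLp 2 (Sum.elim
    (fun s => if a (.inl s) = 0 ∧ a (.inr s) = 0 ∧ ν (.inl s) = 0 then 1 else 0)
    (fun s => if a (.inl s) = 0 ∧ a (.inr s) = 0 ∧ ν (.inl s) ≠ 0 ∧ ν (.inr s) = 0 then 1 else 0))
  have hcase : ∀ t : ℝ, 0 < t → ∀ s,
      (0 < (a + t • b) (.inl s) ∧ (a + t • b) (.inr s) = 0 ∧ ν (.inl s) = 0) ∨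
      ((a + t • b) (.inl s) = 0 ∧ 0 < (a + t • b) (.inr s) ∧ ν (.inr s) = 0) ∨
      ((a + t • b) (.inl s) = 0 ∧ (a + t • b) (.inr s) = 0 ∧ ν (.inl s) ≤ 0 ∧ ν (.inr s) ≤ 0) := by
    intro t ht s
    obtain ⟨h1, h2, h3⟩ := h s
    obtain ⟨hy, hz, hyz⟩ := ha s
    simp only [PiLp.add_apply, PiLp.smul_apply, smul_eq_mul, b, Sum.elim_inl, Sum.elim_inr]
    rcases hy.eq_or_lt with hy | hy
    · rcases hz.eq_or_lt with hz | hz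
      · by_cases hu : ν (.inl s) = 0
        · left
          simp [← hy, ← hz, hu, ht]
        · by_cases hv : ν (.inr s) = 0
          · right; left
            simp [← hy, ← hz, hu, hv, ht]
          · right; right
            rcases h3 ⟨hy.symm, hz.symm⟩ with h | h
            · simp only [Left.neg_pos_iff] at h
              simp [← hy, ← hz, hu, hv, h.1.le, h.2.le]
            · simp [hu, hv] at h
      · right; left
        simp [← hy, hz, hz.ne', h2 ⟨hy.symm, hz⟩]
    · left
      have hz0 := (mul_eq_zero.1 hyz).resolve_left hy.ne'
      simp [hy, hy.ne', hz0, h1 ⟨hy, hz0⟩]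
  have ht : ∀ k : ℕ, (0 : ℝ) < 1 / ((k : ℝ) + 1) := fun k => by positivity
  refine ⟨fun k => a + (1 / ((k : ℝ) + 1)) • b, fun _ => ν, fun k s => ?_,
    fun k => mem_regularNormalCone_complSet (hcase _ (ht k)), ?_, tendsto_const_nhds⟩
  · rcases hcase _ (ht k) s with ⟨h1, h2, -⟩ | ⟨h1, h2, -⟩ | ⟨h1, h2, -⟩
    · exact ⟨h1.le, h2.ge, by rw [h2, mul_zero]⟩
    · exact ⟨h1.ge, h2.le, by rw [h1, zero_mul]⟩
    · exact ⟨h1.ge, h2.ge, by rw [h1, zero_mul]⟩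
  · simpa using tendsto_const_nhds.add
      ((tendsto_one_div_add_atTop_nhds_zero_nat (𝕜 := ℝ)).smul_const b)

end ComplementaritySet

/-- The bound is proved with each `c > ε` in place of `ε`, and then `c` decreases to `ε`. The proof
exhibits an element of the stationarity set, so the bound does not come from `Metric.infDist` being
zero on the empty set. -/
theorem infDist_stationaritySet_le {N n m : ℕ} {Φ : EuclideanSpace ℝ (WIdx N n m) → ℝ}
    {w : EuclideanSpace ℝ (WIdx N n m)} (hw : yzPart w ∈ complSet (PairIdx N m)) {ε : ℝ}
    (h : rIn Φ w ≤ ε) :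
    Metric.infDist 0 (stationaritySet Φ w) ≤ Real.sqrt (Fintype.card (WIdx N n m)) * ε := by
  have hlim : Tendsto (fun c => Real.sqrt (Fintype.card (WIdx N n m)) * c) (𝓝[>] ε)
      (𝓝 (Real.sqrt (Fintype.card (WIdx N n m)) * ε)) :=
    ((continuous_const.mul continuous_id).tendsto ε).mono_left nhdsWithin_le_nhds
  refine ge_of_tendsto hlim ?_
  filter_upwards [self_mem_nhdsWithin] with c hc
  obtain ⟨u, v, huv, hle⟩ := exists_multiplier_of_rIn_lt (h.trans_lt hc)
  have hmem : gradient Φ w - slackVec u v ∈ stationaritySet Φ w := by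
    refine ⟨-slackVec u v, ?_, mem_limitingNormalCone_complSet hw fun l => ?_, sub_eq_add_neg _ _⟩
    · ext s
      simp [xPart, slackVec]
    · obtain ⟨h1, h2, h3⟩ := huv l
      simp only [yzPart, slackVec, PiLp.neg_apply, Sum.elim_inr, Sum.elim_inl, neg_neg, neg_eq_zero]
      exact ⟨h1, h2, h3⟩
  refine (Metric.infDist_le_dist_of_mem hmem).trans ?_
  rw [dist_zero_left]
  exact norm_le_sqrt_card_mul (rIn_nonneg.trans (h.trans hc.le)) hle

/-! ### The outer loop: penalties, inactive multipliers, approximate stationarity. -/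

namespace IsSafeguardedAuLa

variable {N n p q e d m : ℕ} {D : TrajData N n p q e d m}
  {Sκ : ℕ → (HBarIdx N q e m → ℝ) → (HBarIdx N q e m → ℝ)}
  {Sμ : ℕ → (Fin (N + 1) × Fin d → ℝ) → (Fin (N + 1) × Fin d → ℝ)}
  {γ η : ℝ} {w : ℕ → EuclideanSpace ℝ (WIdx N n m)}
  {κ κbar : ℕ → HBarIdx N q e m → ℝ} {μ μbar : ℕ → Fin (N + 1) × Fin d → ℝ} {ρh ρg : ℕ → ℝ}

theorem penalties_pos (hrun : IsSafeguardedAuLa D Sκ Sμ γ η w κ κbar μ μbar ρh ρg) (hγ : 1 < γ)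
    (k : ℕ) : 0 < ρh k ∧ 0 < ρg k := by
  have hγ0 : 0 < γ := one_pos.trans hγ
  induction k with
  | zero => exact hrun.penalty_pos
  | succ k ih =>
    by_cases hk : k = 0 ∨ outerViolation D (w (k + 1)) (μ (k + 1)) ≤ η * outerViolation D (w k) (μ k)
    · obtain ⟨h1, h2⟩ := hrun.penalty_keep k hk
      rwa [h1, h2]
    · obtain ⟨h1, h2⟩ := hrun.penalty_increase k hk
      rw [h1, h2]
      exact ⟨mul_pos hγ0 ih.1, mul_pos hγ0 ih.2⟩

theorem monotone_penalty (hrun : IsSafeguardedAuLa D Sκ Sμ γ η w κ κbar μ μbar ρh ρg)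
    (hγ : 1 < γ) : Monotone ρg := by
  refine monotone_nat_of_le_succ fun k => ?_
  by_cases hk : k = 0 ∨ outerViolation D (w (k + 1)) (μ (k + 1)) ≤ η * outerViolation D (w k) (μ k)
  · exact (hrun.penalty_keep k hk).2.ge
  · rw [(hrun.penalty_increase k hk).2]
    exact le_mul_of_one_le_left (hrun.penalties_pos hγ k).2.le hγ.le

/-- Either the penalties diverge or the outer violation vanishes. -/
theorem tendsto_penalty_or_violation
    (hrun : IsSafeguardedAuLa D Sκ Sμ γ η w κ κbar μ μbar ρh ρg) (hγ : 1 < γ) (hη0 : 0 ≤ η)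
    (hη1 : η < 1) :
    Tendsto ρg atTop atTop ∨ Tendsto (fun k => outerViolation D (w k) (μ k)) atTop (𝓝 0) := by
  refine (tendsto_atTop_of_monotone (hrun.monotone_penalty hγ)).imp_right ?_
  rintro ⟨L, hL⟩
  have hLpos : 0 < L :=
    (hrun.penalties_pos hγ 0).2.trans_le ((hrun.monotone_penalty hγ).ge_of_tendsto hL 0)
  -- If `ρg` converges to `L > 0`, this difference tends to `(1 - γ) L ≠ 0`, so the penalty is
  -- increased only finitely often. From then on, past the exempt step `k = 0`, the violation
  -- contracts by `η`.
  have hne : ∀ᶠ k in atTop, ρg (k + 1) - γ * ρg k ≠ 0 := by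
    refine ((hL.comp (tendsto_add_atTop_nat 1)).sub (hL.const_mul γ)).eventually_ne ?_
    nlinarith
  obtain ⟨K, hK⟩ := eventually_atTop.1 (hne.and (eventually_ge_atTop 1))
  have hstep : ∀ k ≥ K, outerViolation D (w (k + 1)) (μ (k + 1)) ≤
      η * outerViolation D (w k) (μ k) := by
    intro k hk
    by_contra hcon
    obtain ⟨h1, h2⟩ := hK k hk
    refine h1 (sub_eq_zero.2 (hrun.penalty_increase k ?_).2)
    rintro (h | h)
    · omega
    · exact hcon h
  have hgeom : ∀ j, outerViolation D (w (j + K)) (μ (j + K)) ≤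
      η ^ j * outerViolation D (w K) (μ K) := by
    intro j
    induction j with
    | zero => simp
    | succ j ih =>
      have h := hstep (j + K) (by omega)
      rw [show j + 1 + K = j + K + 1 by omega, pow_succ', mul_assoc]
      exact h.trans (mul_le_mul_of_nonneg_left ih hη0)
  rw [← tendsto_add_atTop_iff_nat K]
  refine squeeze_zero (fun j => (norm_nonneg _).trans (le_max_left _ _)) hgeom ?_
  simpa using (tendsto_pow_atTop_nhds_zero_of_lt_one hη0 hη1).mul_const _

/-- Multipliers of inequalities that are inactive at a limit vanish asymptotically. -/
theorem tendsto_multiplier_of_inactive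
    (hrun : IsSafeguardedAuLa D Sκ Sμ γ η w κ κbar μ μbar ρh ρg) (hγ : 1 < γ) (hη0 : 0 ≤ η)
    (hη1 : η < 1) {C : ℝ} (hC : ∀ k, ‖μbar k‖ ≤ C) {φ : ℕ → ℕ} (hφ : Tendsto φ atTop atTop)
    {i : Fin (N + 1) × Fin d} {L : ℝ} (hL : L < 0)
    (hlim : Tendsto (fun j => D.vertical.g i (w (φ j + 1))) atTop (𝓝 L)) :
    Tendsto (fun j => μ (φ j + 1) i) atTop (𝓝 0) := by
  rcases hrun.tendsto_penalty_or_violation hγ hη0 hη1 with h | h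
  -- Diverging penalty: the bounded safeguarded multiplier is outweighed and the update is
  -- eventually exactly zero.
  · have h1 : Tendsto (fun j => ρg (φ j) * D.vertical.g i (w (φ j + 1))) atTop atBot :=
      (h.comp hφ).atTop_mul_neg hL hlim
    refine tendsto_const_nhds.congr' ?_
    filter_upwards [h1.eventually_le_atBot (-C)] with j hj
    have h2 := (le_abs_self _).trans ((norm_le_pi_norm (μbar (φ j)) i).trans (hC _))
    rw [hrun.update_mu, max_eq_right (by linarith)]
  · have hφ1 : Tendsto (fun j => φ j + 1) atTop atTop := (tendsto_add_atTop_nat 1).comp hφ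
    have h1 : Tendsto (fun j => min (μ (φ j + 1) i) (-D.vertical.g i (w (φ j + 1)))) atTop
        (𝓝 0) := by
      refine squeeze_zero_norm (fun j => ?_) (h.comp hφ1)
      exact (norm_le_pi_norm (fun i => min (μ (φ j + 1) i) (-D.vertical.g i (w (φ j + 1)))) i).trans
        (le_max_left _ _)
    -- Vanishing violation: the minimum tends to zero while `-g` tends to `-L > 0`, so the minimum
    -- is eventually the multiplier.
    refine h1.congr' ?_
    filter_upwards [h1.eventually_lt hlim.neg (by simpa using hL)] with j hj
    rcases min_choice (μ (φ j + 1) i) (-D.vertical.g i (w (φ j + 1))) with h' | h'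
    · exact h'
    · exact absurd h' hj.ne

theorem exists_approx_stationary (hD : D.Smooth)
    (hrun : IsSafeguardedAuLa D Sκ Sμ γ η w κ κbar μ μbar ρh ρg) (hγ : 1 < γ) {k : ℕ} {c : ℝ}
    (hc : rIn (D.aula (ρh k) (ρg k) (κbar k) (μbar k)) (w (k + 1)) < c) :
    ∃ u v, (u, v) ∈ multM (w (k + 1)) ∧
      ‖gradient D.vertical.f (w (k + 1)) +
        D.vertical.gradComb (w (k + 1)) (μ (k + 1)) (κ (k + 1)) u v‖ ≤
          Real.sqrt (Fintype.card (WIdx N n m)) * c := by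
  obtain ⟨u, v, huv, hle⟩ := exists_multiplier_of_rIn_lt hc
  refine ⟨u, v, huv, ?_⟩
  obtain ⟨hρh, hρg⟩ := hrun.penalties_pos hγ k
  have hgrad : gradient D.vertical.f (w (k + 1)) +
      D.vertical.gradComb (w (k + 1)) (μ (k + 1)) (κ (k + 1)) u v =
        gradient (D.aula (ρh k) (ρg k) (κbar k) (μbar k)) (w (k + 1)) - slackVec u v := by
    rw [hD.gradient_aula hρh hρg, ← sum_smul_gradient_slack u v (w (k + 1))]
    simp only [← hrun.update_kappa, ← hrun.update_mu]
    change _ + (_ + _ - _ - _) = _ + _ + _ - (_ + _)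
    rw [sub_sub, ← add_sub_assoc, add_assoc, add_comm (∑ i, μ (k + 1) i • _)]
    rfl
  rw [hgrad]
  exact norm_le_sqrt_card_mul (rIn_nonneg.trans hc.le) hle

end IsSafeguardedAuLa

/-! ### From the vertical form back to the original problem. -/

theorem inner_gradient_comp_xPart {N n m : ℕ} {F : EuclideanSpace ℝ (XIdx N n) → ℝ}
    (hF : ContDiff ℝ 1 F) (w a : EuclideanSpace ℝ (WIdx N n m)) :
    inner ℝ (gradient (fun w => F (xPart w)) w) a = inner ℝ (gradient F (xPart w)) (xPart a) := by
  rw [inner_gradient_left, inner_gradient_left]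
  have := ((hF.differentiable one_ne_zero (xPart w)).hasFDerivAt.comp w
    (xPartL (N := N) (n := n) (m := m)).hasFDerivAt).fderiv
  exact DFunLike.congr_fun this a

theorem inner_gradient_yPart {N n m : ℕ} (l : PairIdx N m)
    (w a : EuclideanSpace ℝ (WIdx N n m)) :
    inner ℝ (gradient (fun w : EuclideanSpace ℝ (WIdx N n m) => yPart w l) w) a = yPart a l := by
  rw [show gradient (fun w : EuclideanSpace ℝ (WIdx N n m) => yPart w l) w = _ from
    gradient_apply_coord (Sum.inr (Sum.inl l)) w]
  exact (EuclideanSpace.inner_single_left _ _ _).trans (by simp [yPart])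

theorem inner_gradient_zPart {N n m : ℕ} (l : PairIdx N m)
    (w a : EuclideanSpace ℝ (WIdx N n m)) :
    inner ℝ (gradient (fun w : EuclideanSpace ℝ (WIdx N n m) => zPart w l) w) a = zPart a l := by
  rw [show gradient (fun w : EuclideanSpace ℝ (WIdx N n m) => zPart w l) w = _ from
    gradient_apply_coord (Sum.inr (Sum.inr l)) w]
  exact (EuclideanSpace.inner_single_left _ _ _).trans (by simp [zPart])

namespace TrajData

variable {N n p q e d m : ℕ} {D : TrajData N n p q e d m}

theorem Smooth.inner_gradient_hbar_compG (hD : D.Smooth) (l : PairIdx N m)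
    (w a : EuclideanSpace ℝ (WIdx N n m)) :
    inner ℝ (gradient (D.hbar (.inr (.inl l))) w) a =
      inner ℝ (gradient (D.original.G l) (xPart w)) (xPart a) - yPart a l := by
  rw [← inner_gradient_comp_xPart (hD.contDiff_G l), ← inner_gradient_yPart l w a]
  simp only [inner_gradient_left]
  exact DFunLike.congr_fun (fderiv_fun_sub
    (((hD.contDiff_G l).comp contDiff_xPart).differentiable one_ne_zero w)
    ((contDiff_yPart l).differentiable one_ne_zero w)) a

theorem Smooth.inner_gradient_hbar_compH (hD : D.Smooth) (l : PairIdx N m)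
    (w a : EuclideanSpace ℝ (WIdx N n m)) :
    inner ℝ (gradient (D.hbar (.inr (.inr l))) w) a =
      inner ℝ (gradient (D.original.H l) (xPart w)) (xPart a) - zPart a l := by
  rw [← inner_gradient_comp_xPart (hD.contDiff_H l), ← inner_gradient_zPart l w a]
  simp only [inner_gradient_left]
  exact DFunLike.congr_fun (fderiv_fun_sub
    (((hD.contDiff_H l).comp contDiff_xPart).differentiable one_ne_zero w)
    ((contDiff_zPart l).differentiable one_ne_zero w)) a

/-- Gradients of the two forms live in different spaces, so they are compared through directional
derivatives. Choosing `a` in one block isolates the `X`, `Y` or `Z` component of stationarity. -/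
theorem Smooth.inner_gradient_add_gradComb (hD : D.Smooth)
    (lam : Fin (N + 1) × Fin d → ℝ) (κ : HBarIdx N q e m → ℝ) (u v : PairIdx N m → ℝ)
    (w a : EuclideanSpace ℝ (WIdx N n m)) :
    inner ℝ (gradient D.vertical.f w + D.vertical.gradComb w lam κ u v) a =
      inner ℝ (gradient D.cost (xPart w)) (xPart a) +
        (∑ i, lam i * inner ℝ (gradient (D.original.g i) (xPart w)) (xPart a) +
        (∑ j, κ (.inl j) * inner ℝ (gradient (D.eqFun j) (xPart w)) (xPart a) +
        (∑ l, κ (.inr (.inl l)) *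
          (inner ℝ (gradient (D.original.G l) (xPart w)) (xPart a) - yPart a l) +
        ∑ l, κ (.inr (.inr l)) *
          (inner ℝ (gradient (D.original.H l) (xPart w)) (xPart a) - zPart a l))) -
        ∑ l, u l * yPart a l - ∑ l, v l * zPart a l) := by
  have hdf : inner ℝ (gradient D.vertical.f w) a =
      inner ℝ (gradient D.cost (xPart w)) (xPart a) :=
    inner_gradient_comp_xPart hD.contDiff_cost w a
  have hdg : ∀ i, inner ℝ (gradient (D.vertical.g i) w) a =
      inner ℝ (gradient (D.original.g i) (xPart w)) (xPart a) :=
    fun i => inner_gradient_comp_xPart (hD.contDiff_g i) w a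
  have hdh : ∀ j, inner ℝ (gradient (D.vertical.h (.inl j)) w) a =
      inner ℝ (gradient (D.eqFun j) (xPart w)) (xPart a) :=
    fun j => inner_gradient_comp_xPart (hD.contDiff_eqFun j) w a
  have hdy : ∀ l, inner ℝ (gradient (D.vertical.G l) w) a = yPart a l :=
    fun l => inner_gradient_yPart l w a
  have hdz : ∀ l, inner ℝ (gradient (D.vertical.H l) w) a = zPart a l :=
    fun l => inner_gradient_zPart l w a
  have hdG : ∀ l, inner ℝ (gradient (D.vertical.h (.inr (.inl l))) w) a =
      inner ℝ (gradient (D.original.G l) (xPart w)) (xPart a) - yPart a l :=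
    fun l => hD.inner_gradient_hbar_compG l w a
  have hdH : ∀ l, inner ℝ (gradient (D.vertical.h (.inr (.inr l))) w) a =
      inner ℝ (gradient (D.original.H l) (xPart w)) (xPart a) - zPart a l :=
    fun l => hD.inner_gradient_hbar_compH l w a
  simp only [MPCC.gradComb, inner_add_left, inner_sub_left, sum_inner, inner_smul_left,
    conj_trivial, Fintype.sum_sum_type, hdf, hdg, hdh, hdy, hdz, hdG, hdH]

/-- Testing slack directions gives `-κ - u = 0` and `-κ - v = 0` on the respective blocks;
substituted into the `X`-component, these are the terms `-u ∇G` and `-v ∇H`. Feasibility gives `G =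
y` and `H = z`, so the index sets agree. -/
theorem Smooth.mStationary_original (hD : D.Smooth) {w : EuclideanSpace ℝ (WIdx N n m)}
    (h : D.vertical.MStationary w) : D.original.MStationary (xPart w) := by
  obtain ⟨⟨hg, hh, hc⟩, lam, κ, u, v, hsum, hlam, hu, hv, hQ⟩ := h
  have hG : ∀ l, D.original.G l (xPart w) = yPart w l := fun l =>
    sub_eq_zero.1 (hh (.inr (.inl l)))
  have hH : ∀ l, D.original.H l (xPart w) = zPart w l := fun l =>
    sub_eq_zero.1 (hh (.inr (.inr l)))
  have hkey := fun a => (hD.inner_gradient_add_gradComb lam κ u v w a).symm.trans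
    (by rw [hsum, inner_zero_left])
  have hκy : ∀ l, κ (.inr (.inl l)) = -u l := by
    intro l
    have := hkey (EuclideanSpace.single (.inr (.inl l)) 1)
    have hx0 : xPart (EuclideanSpace.single (.inr (.inl l)) 1 : EuclideanSpace ℝ (WIdx N n m)) = 0 := by
      ext s
      simp [xPart]
    rw [hx0] at this
    simp [yPart, zPart] at this
    linarith
  have hκz : ∀ l, κ (.inr (.inr l)) = -v l := by
    intro l
    have := hkey (EuclideanSpace.single (.inr (.inr l)) 1)
    have hx0 : xPart (EuclideanSpace.single (.inr (.inr l)) 1 : EuclideanSpace ℝ (WIdx N n m)) = 0 := by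
      ext s
      simp [xPart]
    rw [hx0] at this
    simp [yPart, zPart] at this
    linarith
  refine ⟨⟨hg, fun j => hh (.inl j), fun l => ?_⟩, lam, fun j => κ (.inl j), u, v, ?_, hlam,
    fun l hl => hu l ?_, fun l hl => hv l ?_, fun l hl => hQ l ?_⟩
  · rw [hG, hH]
    exact hc l
  · refine ext_inner_right ℝ fun b => ?_
    have := hkey (WithLp.toLp 2 (Sum.elim b 0))
    have hx : xPart (WithLp.toLp 2 (Sum.elim b 0) : EuclideanSpace ℝ (WIdx N n m)) = b := rfl
    have hy0 : ∀ l, yPart (WithLp.toLp 2 (Sum.elim b 0) : EuclideanSpace ℝ (WIdx N n m)) l = 0 :=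
      fun _ => rfl
    have hz0 : ∀ l, zPart (WithLp.toLp 2 (Sum.elim b 0) : EuclideanSpace ℝ (WIdx N n m)) l = 0 :=
      fun _ => rfl
    simp only [hx, hy0, hz0, hκy, hκz, mul_zero, sub_zero, Finset.sum_const_zero, neg_mul,
      Finset.sum_neg_distrib] at this
    simp only [MPCC.gradComb, inner_add_left, inner_sub_left, sum_inner, inner_smul_left,
      inner_zero_left, conj_trivial]
    change inner ℝ (gradient D.cost (xPart w)) b + (_ + ∑ j, κ (.inl j) *
      inner ℝ (gradient (D.eqFun j) (xPart w)) b - _ - _) = 0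
    linarith
  · exact ⟨hl.1.trans_eq (hG l), (hH l).symm.trans hl.2⟩
  · exact ⟨(hG l).symm.trans hl.1, hl.2.trans_eq (hH l)⟩
  · exact ⟨(hG l).symm.trans hl.1, (hH l).symm.trans hl.2⟩

end TrajData

theorem mainTheorem2 {N n p q e d m : ℕ} (D : TrajData N n p q e d m) (hD : D.Smooth)
    (Sκ : ℕ → (HBarIdx N q e m → ℝ) → (HBarIdx N q e m → ℝ))
    (Sμ : ℕ → (Fin (N + 1) × Fin d → ℝ) → (Fin (N + 1) × Fin d → ℝ))
    (γ η : ℝ) (hγ : 1 < γ) (hη0 : 0 ≤ η) (hη1 : η < 1)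
    (w : ℕ → EuclideanSpace ℝ (WIdx N n m))
    (κ κbar : ℕ → HBarIdx N q e m → ℝ) (μ μbar : ℕ → Fin (N + 1) × Fin d → ℝ)
    (ρh ρg : ℕ → ℝ)
    (hrun : IsSafeguardedAuLa D Sκ Sμ γ η w κ κbar μ μbar ρh ρg)
    (hbdd : ∃ B : ℝ, ∀ k, ‖κbar k‖ ≤ B ∧ ‖μbar k‖ ≤ B)
    (ε : ℕ → ℝ) (hεanti : Antitone ε) (hεlim : Tendsto ε atTop (𝓝 0))
    (hin : ∀ k, rIn (D.aula (ρh k) (ρg k) (κbar k) (μbar k)) (w (k + 1)) ≤ ε k) :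
    (∀ k, Metric.infDist 0
        (stationaritySet (D.aula (ρh k) (ρg k) (κbar k) (μbar k)) (w (k + 1)))
          ≤ Real.sqrt (Fintype.card (WIdx N n m)) * ε k) ∧
    ∀ wstar : EuclideanSpace ℝ (WIdx N n m),
      MapClusterPt wstar atTop w → D.vertical.Feasible wstar → D.vertical.RCPLD wstar →
        D.vertical.MStationary wstar ∧ D.original.MStationary (xPart wstar) := by
  refine ⟨fun k => infDist_stationaritySet_le (hrun.hard_constraint k) (hin k),
    fun wstar hcl hfeas hR => ?_⟩
  suffices h : D.vertical.MStationary wstar from ⟨h, hD.mStationary_original h⟩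
  obtain ⟨C, hC⟩ := hbdd
  obtain ⟨ψ, hψ, hlimψ⟩ := hcl.tendsto_subseq
  -- The shift skips the possible index zero: `w 0` is arbitrary, and only later iterates come from
  -- an inner solve.
  have hex : ∀ j, ∃ k, ψ (j + 1) = k + 1 := fun j =>
    Nat.exists_eq_succ_of_ne_zero ((Nat.zero_le _).trans_lt (hψ j.lt_succ_self)).ne'
  choose φ hφ using hex
  have hφt : Tendsto φ atTop atTop := by
    have h1 : Tendsto (fun j => φ j + 1) atTop atTop := by
      simpa only [← hφ, Function.comp_def] using hψ.tendsto_atTop.comp (tendsto_add_atTop_nat 1)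
    exact tendsto_atTop.2 fun b => (h1.eventually_ge_atTop (b + 1)).mono fun j hj => by omega
  have hw : Tendsto (fun j => w (φ j + 1)) atTop (𝓝 wstar) := by
    simpa only [← hφ, Function.comp_def] using hlimψ.comp (tendsto_add_atTop_nat 1)
  -- The vanishing extra term makes the inequality strict, as needed to select near-minimizers.
  have hc : ∀ j, rIn (D.aula (ρh (φ j)) (ρg (φ j)) (κbar (φ j)) (μbar (φ j))) (w (φ j + 1)) <
      ε (φ j) + 1 / ((j : ℝ) + 1) := fun j =>
    (hin (φ j)).trans_lt (lt_add_of_pos_right _ (by positivity))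
  choose u v huv hle using fun j => hrun.exists_approx_stationary hD hγ (hc j)
  have hy : ∀ l, Tendsto (fun j => yPart (w (φ j + 1)) l) atTop (𝓝 (yPart wstar l)) := fun l =>
    ((contDiff_yPart l).continuous.tendsto wstar).comp hw
  have hz : ∀ l, Tendsto (fun j => zPart (w (φ j + 1)) l) atTop (𝓝 (zPart wstar l)) := fun l =>
    ((contDiff_zPart l).continuous.tendsto wstar).comp hw
  have hcompl : ∀ j l, 0 ≤ yPart (w (φ j + 1)) l ∧ 0 ≤ zPart (w (φ j + 1)) l ∧
      yPart (w (φ j + 1)) l * zPart (w (φ j + 1)) l = 0 := fun j l => hrun.hard_constraint (φ j) l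
  refine MPCC.mStationary_of_tendsto hfeas hR hD.contDiff_vertical_f.continuous_gradient.continuousAt
    (fun c => (hD.continuous_vertical_grad c).continuousAt) hw
    (lam := fun j => μ (φ j + 1)) (mu := fun j => κ (φ j + 1)) (u := u) (v := v)
    (fun j i => by rw [hrun.update_mu]; exact le_max_right _ _) (fun i hi => ?_) ?_ ?_ ?_ ?_
  · exact hrun.tendsto_multiplier_of_inactive hγ hη0 hη1 (fun k => (hC k).2) hφt hi
      (((hD.contDiff_vertical_g i).continuous.tendsto wstar).comp hw)
  · refine eventually_all.2 fun l => ?_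
    by_cases hl : l ∈ D.vertical.idxp0 wstar
    · filter_upwards [(hy l).eventually (lt_mem_nhds hl.1)] with j hj _
      exact (huv j l).1 ⟨hj, (mul_eq_zero.1 (hcompl j l).2.2).resolve_left hj.ne'⟩
    · exact Eventually.of_forall fun j h => absurd h hl
  · refine eventually_all.2 fun l => ?_
    by_cases hl : l ∈ D.vertical.idx0p wstar
    · filter_upwards [(hz l).eventually (lt_mem_nhds hl.2)] with j hj _
      exact (huv j l).2.1 ⟨(mul_eq_zero.1 (hcompl j l).2.2).resolve_right hj.ne', hj⟩
    · exact Eventually.of_forall fun j h => absurd h hl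
  -- A pair biactive at the limit may be of any type at the iterates; off the corner one multiplier
  -- is zero, and the axes belong to `QM`.
  · refine Eventually.of_forall fun j l _ => ?_
    obtain ⟨h1, h2, h3⟩ := huv j l
    obtain ⟨hy', hz', hyz⟩ := hcompl j l
    rcases hy'.eq_or_lt with h | h
    · rcases hz'.eq_or_lt with h' | h'
      · exact h3 ⟨h.symm, h'.symm⟩
      · exact Or.inr (mul_eq_zero_of_right _ (h2 ⟨h.symm, h'⟩))
    · exact Or.inr (mul_eq_zero_of_left
        (h1 ⟨h, (mul_eq_zero.1 hyz).resolve_left h.ne'⟩) _)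
  · refine squeeze_zero_norm hle ?_
    simpa using ((hεlim.comp hφt).add
      (tendsto_one_div_add_atTop_nhds_zero_nat (𝕜 := ℝ))).const_mul
        (Real.sqrt (Fintype.card (WIdx N n m)))
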